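/- \textbf{Lemma 2.} Let $\Phi_F$ (the F-APs) and $\Phi_R$ (the RRHs) be independent homogeneous Poisson point processes on $\mathbb{R}^2$ with densities $\lambda_F,\lambda_R>0$. The typical user is at the origin, and $r_x$ denotes the distance of a point $x$ from the origin. Stations have transmit powers $P_F,P_R>0$, the path loss exponent is $\alpha>2$, and the channel coefficients $h_x$ ($x\in\Phi_F\cup\Phi_R$) are i.i.d. $CN(0,1)$ (so $|h_x|^2\sim\mathrm{Exp}(1)$), independent of the locations. Let $x_0$ and $y_0$ be the F-AP and the RRH closest to the origin, and let $k>0$. The user is associated with the F-AP $x_0$ if $k\,r_{x_0}\le r_{y_0}$, and with the RRH $y_0$ if $k\,r_{x_0}>r_{y_0}$. Let $B\ge 0$ be the number of feedback bits, $L=2^B$, $N_B\ge 2$ the number of antennas at each RRH, and $$\zeta=1-L\,\beta\!\left(L,\tfrac{N_B}{N_B-1}\right),\qquad \upsilon=2^{-B/(N_B-1)},\qquad \beta(a,b)=\frac{\Gamma(a)\Gamma(b)}{\Gamma(a+b)}.$$ For noise variance $\sigma^2\ge 0$ the SINR of a user served by $x_0$, respectively by $y_0$, is $$\gamma^F=\frac{P_F|h_{x_0}|^2r_{x_0}^{-\alpha}}{\sum_{x\in\Phi_F\setminus\{x_0\}}P_F|h_x|^2r_x^{-\alpha}+\sum_{y\in\Phi_R}P_R|h_y|^2r_y^{-\alpha}+\sigma^2},$$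 $$\gamma^R=\frac{P_R\,\zeta\,|h_{y_0}|^2r_{y_0}^{-\alpha}}{\sum_{x\in\Phi_F}P_F|h_x|^2r_x^{-\alpha}+\upsilon\sum_{y\in\Phi_R\setminus\{y_0\}}P_R|h_y|^2r_y^{-\alpha}+\sigma^2}.$$ For a threshold $\delta>0$, let $S_F=\mathbb{P}(\gamma^F>\delta\mid k\,r_{x_0}\le r_{y_0})$ and $S_R=\mathbb{P}(\gamma^R>\delta\mid k\,r_{x_0}>r_{y_0})$ be the success delivery probabilities of F-AP users and of RRH users. Then in the interference-limited regime, that is, both for $\sigma^2=0$ and in the limit $\sigma^2\to0^+$, $$S_F=\frac{\lambda_F+k^2\lambda_R}{\lambda_F\left(1+\rho(\delta,\alpha)\right)+k^2\lambda_R\left(1+\rho\!\left(\frac{\delta P_R}{k^\alpha P_F},\alpha\right)\right)},$$ $$S_R=\frac{\lambda_F+k^2\lambda_R}{\lambda_F\left(1+\rho(\delta_1,\alpha)\right)+k^2\lambda_R\left(1+\rho(\delta_2,\alpha)\right)},$$ where $$\delta_1=\frac{\delta k^\alpha P_F}{\zeta P_R},\qquad \delta_2=\frac{\upsilon\delta}{\zeta},\qquad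 \rho(\delta,\alpha)=\int_{\delta^{-2/\alpha}}^\infty\frac{\delta^{2/\alpha}}{1+u^{\alpha/2}}\,du.$$ -/

import Mathlib

open MeasureTheory ProbabilityTheory Filter Topology
open scoped ENNReal NNReal

noncomputable section

namespace FRAN

/-- The plane in which the base stations are deployed; the typical user sits at the origin `0`. -/
abbrev Plane : Type := EuclideanSpace ℝ (Fin 2)

/-- The two tiers of base stations: F-APs and RRHs. -/
inductive Tier : Type
  | F : Tier
  | R : Tier

/-! ### Point processes -/

/-- The number (possibly infinite) of the random points `X 0, X 1, …` that lie in `B`. -/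
def pointCount {Ω : Type*} (X : ℕ → Ω → Plane) (B : Set Plane) (ω : Ω) : ℝ≥0∞ :=
  ∑' n, B.indicator (fun _ => (1 : ℝ≥0∞)) (X n ω)

/-- `X 0, X 1, …` is a measurable enumeration (in any order) of the points of a homogeneous Poisson
point process on the plane with density `lam`: the number of points in a Borel set `B` of finite
area is Poisson distributed with mean `lam * area B`, and the numbers of points in finitely many
pairwise disjoint such sets are mutually independent. (For `lam > 0` a homogeneous Poisson point
process has almost surely countably infinitely many points, so it is enumerated by `ℕ`.) -/
structure IsHomogeneousPPP {Ω : Type*} [MeasurableSpace Ω] (P : Measure Ω) (lam : ℝ)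
    (X : ℕ → Ω → Plane) : Prop where
  measurable_point : ∀ n, Measurable (X n)
  count_law : ∀ B : Set Plane, MeasurableSet B → volume B < ∞ →
    P.map (pointCount X B) =
      (poissonMeasure (lam * volume.real B).toNNReal).map (fun j : ℕ => (j : ℝ≥0∞))
  count_indep : ∀ (m : ℕ) (B : Fin m → Set Plane),
    (∀ i, MeasurableSet (B i)) → (∀ i, volume (B i) < ∞) →
    Pairwise (fun i j => Disjoint (B i) (B j)) →
    iIndepFun (fun i => pointCount X (B i)) P

/-- The law `CN(0,1)` on `ℂ`: independent real and imaginary parts, each `N(0,1/2)`. -/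
def complexNormal : Measure ℂ :=
  ((gaussianReal 0 (1 / 2)).prod (gaussianReal 0 (1 / 2))).map
    Complex.measurableEquivRealProd.symm

/-- The two-tier network with Rayleigh fading: `X t n` is the location of the `n`-th base station
of tier `t`, and `h t n` its channel coefficient to the typical user. The tiers are independent
homogeneous Poisson point processes with densities `lam t`, and the channel coefficients are
independent `CN(0,1)` variables that are independent of all locations. -/
structure IsTwoTierNetwork {Ω : Type*} [MeasurableSpace Ω] (P : Measure Ω) (lam : Tier → ℝ)
    (X : Tier → ℕ → Ω → Plane) (h : Tier → ℕ → Ω → ℂ) : Prop where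
  ppp : ∀ t, IsHomogeneousPPP P (lam t) (X t)
  tiers_indep : iIndepFun (fun (t : Tier) (ω : Ω) (n : ℕ) => X t n ω) P
  fading_measurable : ∀ t n, Measurable (h t n)
  fading_law : ∀ t n, P.map (h t n) = complexNormal
  fading_indep : iIndepFun (fun (i : Tier × ℕ) (ω : Ω) => h i.1 i.2 ω) P
  locations_fading_indep : IndepFun (fun (ω : Ω) (t : Tier) (n : ℕ) => X t n ω)
    (fun (ω : Ω) (t : Tier) (n : ℕ) => h t n ω) P

/-! ### Association -/

/-- The index of a point of the sequence `x` that is closest to the origin (the least such index;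
for a Poisson point process the closest point exists and is unique almost surely). -/
def nearest (x : ℕ → Plane) : ℕ := sInf {n | ∀ m, ‖x n‖ ≤ ‖x m‖}

/-- The distance from the origin to the closest point of the sequence `x`. -/
def nearestDist (x : ℕ → Plane) : ℝ := ‖x (nearest x)‖

/-- The event that the typical user is associated with an F-AP: the distance to the closest RRH is
at least `k` times the distance to the closest F-AP. -/
def assocF {Ω : Type*} (k : ℝ) (X : Tier → ℕ → Ω → Plane) : Set Ω :=
  {ω | k * nearestDist (fun n => X Tier.F n ω) ≤ nearestDist (fun n => X Tier.R n ω)}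

/-- The event that the typical user is associated with an RRH. -/
def assocR {Ω : Type*} (k : ℝ) (X : Tier → ℕ → Ω → Plane) : Set Ω :=
  {ω | nearestDist (fun n => X Tier.R n ω) < k * nearestDist (fun n => X Tier.F n ω)}

/-! ### SINR -/

/-- Power received at the origin from a station at `z` with transmit power `p` and channel
coefficient `g`, for the path loss exponent `α`. -/
def rxPower (α p : ℝ) (z : Plane) (g : ℂ) : ℝ≥0∞ :=
  ENNReal.ofReal (p * ‖g‖ ^ 2 * ‖z‖ ^ (-α))

/-- Total power received from all stations of a tier. -/
def totalPower (α p : ℝ) (x : ℕ → Plane) (g : ℕ → ℂ) : ℝ≥0∞ :=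
  ∑' n, rxPower α p (x n) (g n)

/-- Total power received from all stations of a tier except the closest one. -/
def totalPowerExceptNearest (α p : ℝ) (x : ℕ → Plane) (g : ℕ → ℂ) : ℝ≥0∞ :=
  ∑' n : {n : ℕ // n ≠ nearest x}, rxPower α p (x n) (g n)

/-- SINR of a user served by the closest F-AP. Here `x`, `g` are the locations and channel
coefficients of the F-APs, `y`, `h` those of the RRHs, and `noise` is the noise variance. -/
def sinrF (α PF PR noise : ℝ) (x y : ℕ → Plane) (g h : ℕ → ℂ) : ℝ≥0∞ :=
  rxPower α PF (x (nearest x)) (g (nearest x)) /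
    (totalPowerExceptNearest α PF x g + totalPower α PR y h + ENNReal.ofReal noise)

/-- SINR of a limited-feedback user served by the closest RRH, with quantization coefficient
`ζ` and interference power coefficient `υ`. -/
def sinrR (α PF PR ζ υ noise : ℝ) (x y : ℕ → Plane) (g h : ℕ → ℂ) : ℝ≥0∞ :=
  ENNReal.ofReal ζ * rxPower α PR (y (nearest y)) (h (nearest y)) /
    (totalPower α PF x g + ENNReal.ofReal υ * totalPowerExceptNearest α PR y h
      + ENNReal.ofReal noise)

/-- The quantization coefficient `1 - L β(L, N/(N-1))` with `L = 2^B`, for `B` feedback bits and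
`N` antennas at each RRH. -/
def zeta (B N : ℕ) : ℝ :=
  1 - (2 : ℝ) ^ B * ProbabilityTheory.beta ((2 : ℝ) ^ B) ((N : ℝ) / ((N : ℝ) - 1))

/-- The interference power coefficient `2^(-B/(N-1))`. -/
def upsilon (B N : ℕ) : ℝ := (2 : ℝ) ^ (-((B : ℝ) / ((N : ℝ) - 1)))

/-! ### Success probabilities -/

/-- Success delivery probability of an F-AP user: the conditional probability that the SINR
exceeds `δ`, given association with an F-AP. -/
def successF {Ω : Type*} [MeasurableSpace Ω] (P : Measure Ω) (X : Tier → ℕ → Ω → Plane)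
    (h : Tier → ℕ → Ω → ℂ) (k α PF PR δ noise : ℝ) : ℝ :=
  (P[|assocF k X]).real {ω | ENNReal.ofReal δ <
    sinrF α PF PR noise (fun n => X Tier.F n ω) (fun n => X Tier.R n ω)
      (fun n => h Tier.F n ω) (fun n => h Tier.R n ω)}

/-- Success delivery probability of an RRH user with `B` feedback bits and `N` antennas per RRH:
the conditional probability that the SINR exceeds `δ`, given association with an RRH. -/
def successR {Ω : Type*} [MeasurableSpace Ω] (P : Measure Ω) (X : Tier → ℕ → Ω → Plane)
    (h : Tier → ℕ → Ω → ℂ) (k α PF PR : ℝ) (B N : ℕ) (δ noise : ℝ) : ℝ :=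
  (P[|assocR k X]).real {ω | ENNReal.ofReal δ <
    sinrR α PF PR (zeta B N) (upsilon B N) noise (fun n => X Tier.F n ω) (fun n => X Tier.R n ω)
      (fun n => h Tier.F n ω) (fun n => h Tier.R n ω)}

/-- `ρ(δ,α) = ∫_{δ^{-2/α}}^∞ δ^{2/α} / (1 + u^{α/2}) du`. -/
def rho (δ α : ℝ) : ℝ :=
  ∫ u in Set.Ioi (δ ^ (-2 / α)), δ ^ (2 / α) / (1 + u ^ (α / 2))

/-- The value of the success delivery probability of F-AP users. -/
def formulaF (lamF lamR k α PF PR δ : ℝ) : ℝ :=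
  (lamF + k ^ 2 * lamR) /
    (lamF * (1 + rho δ α) + k ^ 2 * lamR * (1 + rho (δ * PR / (k ^ α * PF)) α))

/-- The value of the success delivery probability of RRH users. -/
def formulaR (lamF lamR k α PF PR : ℝ) (B N : ℕ) (δ : ℝ) : ℝ :=
  (lamF + k ^ 2 * lamR) /
    (lamF * (1 + rho (δ * k ^ α * PF / (zeta B N * PR)) α)
      + k ^ 2 * lamR * (1 + rho (upsilon B N * δ / zeta B N) α))

end FRAN

end

/-! Given all locations, the fading powers are independent Exp(1) variables. If the serving station
is at distance `r₀`, the event SIR > δ says that `|h₀|²` exceeds a sum of terms `cᵢ |hᵢ|²` with `cᵢ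
= s (r₀ / rᵢ)^α`, where `s` depends only on the tier. Its conditional probability is therefore `∏ 1
/ (1 + cᵢ)`, which is `exp` of minus a sum of potentials over the stations (`prob_fading`).

This product is averaged over the locations with the Laplace functional of a Poisson process
(`IsHomogeneousPPP.laplace`). In terms of squared distances each tier is a Poisson process on the
half-line with constant density `c = λπ`. The condition that a tier has no station closer than a
given distance is encoded by an infinite potential, because `exp (-∞) = 0`.

The serving distance is itself random and depends on the process. Instead of conditioning on it, the
reference squared distance `a` is frozen in the potentials while the law of the nearest squared
distance is computed. Setting `a` equal to that distance is justified by dyadic approximation from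
below (`lintegral_potential_nearest`).

By scaling (`lossMass_mul_self`), a serving station at squared distance `t` costs exponents `c₁ t (1
+ ρ(s₁))` and `c₂ k² t (1 + ρ(s₂ / k^α))`. The integral over `t` is thus purely exponential and
gives `λ₁ / (λ₁ (1 + ρ(s₁)) + k² λ₂ (1 + ρ(s₂ / k^α)))`. With `s₁ = s₂ = 0` this is the association
probability, and the quotient of the two is the formula. The RRH case exchanges the tiers and
replaces `k` by `k⁻¹`; ties are null. Vanishing noise is handled by pointwise convergence of the
success events. -/

namespace FRAN

/-! ### The exponential on `[0, ∞]` and its limit theorems -/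

/-- The function `x ↦ exp (-x)` on `[0, ∞]`. -/
noncomputable def expNeg (x : ℝ≥0∞) : ℝ≥0∞ := EReal.exp (-(x : EReal))

@[simp] lemma expNeg_zero : expNeg 0 = 1 := by simp [expNeg]

@[simp] lemma expNeg_top : expNeg ∞ = 0 := by simp [expNeg]

lemma expNeg_ofReal {x : ℝ} (hx : 0 ≤ x) :
    expNeg (ENNReal.ofReal x) = ENNReal.ofReal (Real.exp (-x)) := by
  rw [expNeg, EReal.coe_ennreal_ofReal, max_eq_left hx, ← EReal.coe_neg, EReal.exp_coe]

lemma expNeg_antitone : Antitone expNeg := fun a b h => by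
  apply EReal.exp_monotone
  exact EReal.neg_le_neg_iff.2 (EReal.coe_ennreal_le_coe_ennreal_iff.2 h)

lemma expNeg_le_one (x : ℝ≥0∞) : expNeg x ≤ 1 := by
  simpa using expNeg_antitone (zero_le (a := x))

lemma expNeg_ne_top (x : ℝ≥0∞) : expNeg x ≠ ∞ := ne_top_of_le_ne_top (by simp) (expNeg_le_one x)

lemma expNeg_add (x y : ℝ≥0∞) : expNeg (x + y) = expNeg x * expNeg y := by
  rw [expNeg, expNeg, expNeg, ← EReal.exp_add, EReal.coe_ennreal_add, EReal.neg_add, sub_eq_add_neg]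
  · left; simp
  · right; simp

lemma expNeg_sum {ι : Type*} (s : Finset ι) (f : ι → ℝ≥0∞) :
    expNeg (∑ i ∈ s, f i) = ∏ i ∈ s, expNeg (f i) := by
  classical
  induction s using Finset.induction_on with
  | empty => simp
  | insert a s ha ih => rw [Finset.sum_insert ha, Finset.prod_insert ha, expNeg_add, ih]

lemma expNeg_nat_mul (n : ℕ) (x : ℝ≥0∞) : expNeg (n * x) = expNeg x ^ n := by
  induction n with
  | zero => simp
  | succ n ih => rw [Nat.cast_succ, add_mul, expNeg_add, ih, one_mul, pow_succ]

lemma continuous_expNeg : Continuous expNeg :=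
  ENNReal.continuous_exp.comp (continuous_neg.comp continuous_coe_ennreal_ereal)

@[fun_prop] lemma measurable_expNeg : Measurable expNeg := continuous_expNeg.measurable

/-- Monotone convergence for `∫⁻ (1 - exp (-v))`. -/
lemma tendsto_lintegral_one_sub_expNeg {S : Type*} [MeasurableSpace S] (μ : Measure S)
    {v : ℕ → S → ℝ≥0∞} {w : S → ℝ≥0∞} (hv : ∀ n, Measurable (v n))
    (hmono : ∀ s, Monotone fun n => v n s)
    (hlim : ∀ s, Tendsto (fun n => v n s) atTop (𝓝 (w s))) :
    Tendsto (fun n => ∫⁻ s, (1 - expNeg (v n s)) ∂μ) atTop (𝓝 (∫⁻ s, (1 - expNeg (w s)) ∂μ)) := by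
  refine lintegral_tendsto_of_tendsto_of_monotone (fun n => by fun_prop) ?_ ?_
  · filter_upwards with s n m hnm
    exact tsub_le_tsub_left (expNeg_antitone (hmono s hnm)) 1
  · filter_upwards with s
    exact ENNReal.Tendsto.sub tendsto_const_nhds ((continuous_expNeg.tendsto _).comp (hlim s))
      (Or.inl (by simp))

lemma tendsto_tsum_of_monotone {ι : Type*} {v : ℕ → ι → ℝ≥0∞} {w : ι → ℝ≥0∞}
    (hmono : ∀ i, Monotone fun n => v n i)
    (hlim : ∀ i, Tendsto (fun n => v n i) atTop (𝓝 (w i))) :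
    Tendsto (fun n => ∑' i, v n i) atTop (𝓝 (∑' i, w i)) := by
  let _ : MeasurableSpace ι := ⊤
  simp_rw [← lintegral_count]
  exact lintegral_tendsto_of_tendsto_of_monotone (fun n => measurable_from_top.aemeasurable)
    (by filter_upwards with i using hmono i) (by filter_upwards with i using hlim i)

lemma tendsto_lintegral_expNeg {Ω : Type*} [MeasurableSpace Ω] (P : Measure Ω)
    [IsFiniteMeasure P] {f : ℕ → Ω → ℝ≥0∞} {g : Ω → ℝ≥0∞} (hf : ∀ n, Measurable (f n))
    (hlim : ∀ᵐ ω ∂P, Tendsto (fun n => f n ω) atTop (𝓝 (g ω))) :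
    Tendsto (fun n => ∫⁻ ω, expNeg (f n ω) ∂P) atTop (𝓝 (∫⁻ ω, expNeg (g ω) ∂P)) := by
  refine tendsto_lintegral_of_dominated_convergence (fun _ => 1) (fun n => by fun_prop)
    (fun n => by filter_upwards with ω using expNeg_le_one _) (by simp) ?_
  filter_upwards [hlim] with ω h using (continuous_expNeg.tendsto _).comp h

/-- The Poisson generating function at `q = expNeg c`, summed by the exponential series. The value
`c = ∞` is allowed and gives the void probability: since `0 * ∞ = 0`, only the term `n = 0`
survives. -/
lemma lintegral_poisson_expNeg (r : ℝ≥0) (c : ℝ≥0∞) :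
    ∫⁻ n : ℕ, expNeg (n * c) ∂(poissonMeasure r) = expNeg (r * (1 - expNeg c)) := by
  obtain ⟨q, hq, hq1⟩ : ∃ q : ℝ≥0, expNeg c = q ∧ q ≤ 1 := by
    lift expNeg c to ℝ≥0 using expNeg_ne_top c with q hq
    exact ⟨q, rfl, by exact_mod_cast hq ▸ expNeg_le_one c⟩
  simp_rw [poissonMeasure, lintegral_sum_measure, lintegral_smul_measure, lintegral_dirac,
    expNeg_nat_mul, hq, smul_eq_mul]
  have h1 : (r : ℝ≥0∞) * (1 - q) = ENNReal.ofReal (r * (1 - q)) := by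
    rw [← ENNReal.ofReal_coe_nnreal, ← ENNReal.ofReal_coe_nnreal, ← ENNReal.ofReal_one,
      ← ENNReal.ofReal_sub _ q.coe_nonneg, ← ENNReal.ofReal_mul r.coe_nonneg]
  have h2 : (0 : ℝ) ≤ 1 - q := sub_nonneg.2 (by exact_mod_cast hq1)
  rw [h1, expNeg_ofReal (mul_nonneg r.coe_nonneg h2)]
  have h3 := (NormedSpace.expSeries_div_hasSum_exp ((r : ℝ) * q)).mul_left (Real.exp (-r))
  rw [← Real.exp_eq_exp_ℝ, ← Real.exp_add] at h3
  have h4 : -(r : ℝ) + r * q = -(r * (1 - q)) := by ring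
  rw [h4] at h3
  rw [← h3.tsum_eq, ENNReal.ofReal_tsum_of_nonneg (fun n => by positivity) h3.summable]
  congr 1; ext n
  rw [← ENNReal.ofReal_coe_nnreal, ← ENNReal.ofReal_pow q.coe_nonneg, ← ENNReal.ofReal_mul (by positivity)]
  congr 1
  ring

/-! ### The Laplace functional of a planar Poisson process -/

section Laplace

variable {Ω : Type*} [MeasurableSpace Ω] {P : Measure Ω} {lam : ℝ} {X : ℕ → Ω → Plane}

lemma IsHomogeneousPPP.measurable_pointCount (hX : IsHomogeneousPPP P lam X) {B : Set Plane}
    (hB : MeasurableSet B) : Measurable (pointCount X B) := by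
  refine Measurable.tsum fun n => ?_
  exact (measurable_const.indicator hB).comp (hX.measurable_point n)

lemma IsHomogeneousPPP.lintegral_expNeg_pointCount (hX : IsHomogeneousPPP P lam X) (hlam : 0 ≤ lam)
    {B : Set Plane} (hB : MeasurableSet B) (hB' : volume B < ∞) (c : ℝ≥0∞) :
    ∫⁻ ω, expNeg (pointCount X B ω * c) ∂P
      = expNeg (ENNReal.ofReal lam * (volume B * (1 - expNeg c))) := by
  have h := lintegral_map (μ := P) (f := fun j : ℝ≥0∞ => expNeg (j * c)) (by fun_prop)
    (hX.measurable_pointCount hB)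
  rw [← h, hX.count_law B hB hB', lintegral_map (by fun_prop) (by fun_prop),
    lintegral_poisson_expNeg, ← mul_assoc]
  congr 2
  rw [← ENNReal.ofReal, ENNReal.ofReal_mul hlam, measureReal_def, ENNReal.ofReal_toReal hB'.ne]

lemma IsHomogeneousPPP.laplace_disjoint (hX : IsHomogeneousPPP P lam X) (hlam : 0 ≤ lam)
    {m : ℕ} (B : Fin m → Set Plane) (hB : ∀ i, MeasurableSet (B i)) (hB' : ∀ i, volume (B i) < ∞)
    (hd : Pairwise fun i j => Disjoint (B i) (B j)) (c : Fin m → ℝ≥0∞) :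
    ∫⁻ ω, expNeg (∑ i, pointCount X (B i) ω * c i) ∂P
      = expNeg (ENNReal.ofReal lam * ∑ i, volume (B i) * (1 - expNeg (c i))) := by
  simp_rw [expNeg_sum, Finset.mul_sum, expNeg_sum]
  rw [lintegral_prod_eq_prod_lintegral_of_indepFun Finset.univ
    (fun i ω => expNeg (pointCount X (B i) ω * c i))]
  · exact Finset.prod_congr rfl fun i _ =>
      hX.lintegral_expNeg_pointCount hlam (hB i) (hB' i) (c i)
  · exact (hX.count_indep m B hB hB' hd).comp (fun i j => expNeg (j * c i)) fun i => by fun_prop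
  · intro i
    have := hX.measurable_pointCount (hB i)
    fun_prop

/-- The fibres of `f` over its nonzero values are disjoint sets of finite area, so the sum over the
points is a weighted sum of independent Poisson counts. -/
lemma IsHomogeneousPPP.laplace_simpleFunc (hX : IsHomogeneousPPP P lam X) (hlam : 0 ≤ lam)
    (f : SimpleFunc Plane ℝ≥0∞) (hf : ∀ y, y ≠ 0 → volume (f ⁻¹' {y}) < ∞) :
    ∫⁻ ω, expNeg (∑' n, f (X n ω)) ∂P
      = expNeg (ENNReal.ofReal lam * ∫⁻ x, (1 - expNeg (f x))) := by
  classical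
  -- The fibre over 0 may have infinite area, but it contributes nothing to either side.
  set s := f.range.filter (· ≠ 0) with hs
  let e := s.equivFin
  have key := hX.laplace_disjoint hlam (fun i => f ⁻¹' {(e.symm i : ℝ≥0∞)})
    (fun i => f.measurableSet_fiber _) (fun i => hf _ (Finset.mem_filter.1 (e.symm i).2).2)
    (fun i j hij => by
      refine Disjoint.preimage f (Set.disjoint_singleton.2 fun h => hij ?_)
      exact e.symm.injective (Subtype.ext h))
    (fun i => (e.symm i : ℝ≥0∞))
  have h1 : ∀ g : ℝ≥0∞ → ℝ≥0∞, ∑ i, g (e.symm i : ℝ≥0∞) = ∑ y ∈ s, g y := by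
    intro g
    rw [← Finset.sum_coe_sort s g]
    exact Equiv.sum_comp e.symm (fun y : s => g y)
  have h2 : ∀ (g : ℝ≥0∞ → ℝ≥0∞), g 0 = 0 → ∀ x, g (f x) =
      ∑ y ∈ s, (f ⁻¹' {y}).indicator (fun _ => (1 : ℝ≥0∞)) x * g y := by
    intro g hg x
    by_cases hx : f x = 0
    · rw [hx, hg, Finset.sum_eq_zero]
      intro y hy
      have : y ≠ 0 := (Finset.mem_filter.1 hy).2
      rw [Set.indicator_of_notMem, zero_mul]
      simp [hx, this.symm]
    · rw [Finset.sum_eq_single (f x)]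
      · simp
      · intro y _ hy
        rw [Set.indicator_of_notMem, zero_mul]
        simpa using hy.symm
      · intro h
        exact absurd (Finset.mem_filter.2 ⟨f.mem_range_self x, hx⟩) h
  have h3 : ∀ ω, ∑' n, f (X n ω) = ∑ i, pointCount X (f ⁻¹' {(e.symm i : ℝ≥0∞)}) ω * e.symm i := by
    intro ω
    rw [h1 fun y => pointCount X (f ⁻¹' {y}) ω * y]
    simp_rw [pointCount, ← ENNReal.tsum_mul_right]
    rw [← Summable.tsum_finsetSum fun _ _ => ENNReal.summable]
    exact tsum_congr fun n => h2 id rfl _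
  have h4 : ∫⁻ x, (1 - expNeg (f x)) = ∑ y ∈ s, volume (f ⁻¹' {y}) * (1 - expNeg y) := by
    rw [lintegral_congr (h2 (fun y => 1 - expNeg y) (by simp)), lintegral_finsetSum]
    · refine Finset.sum_congr rfl fun y _ => ?_
      rw [lintegral_mul_const _ (measurable_const.indicator (f.measurableSet_fiber y)),
        lintegral_indicator_const (f.measurableSet_fiber y), one_mul]
    · intro y _
      exact (measurable_const.indicator (f.measurableSet_fiber y)).mul_const _
  simp_rw [h3, key, h4, h1 fun y => volume (f ⁻¹' {y}) * (1 - expNeg y)]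

/-- The Laplace functional of a homogeneous Poisson point process. -/
theorem IsHomogeneousPPP.laplace [IsProbabilityMeasure P] (hX : IsHomogeneousPPP P lam X)
    (hlam : 0 ≤ lam) {v : Plane → ℝ≥0∞} (hv : Measurable v) :
    ∫⁻ ω, expNeg (∑' n, v (X n ω)) ∂P
      = expNeg (ENNReal.ofReal lam * ∫⁻ x, (1 - expNeg (v x))) := by
  -- Cutting off outside growing balls gives the nonzero fibres finite area and keeps the
  -- approximation increasing.
  let f : ℕ → SimpleFunc Plane ℝ≥0∞ := fun n =>
    (SimpleFunc.eapprox v n).restrict (Metric.ball 0 n)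
  have hfa : ∀ n x, f n x = (Metric.ball (0 : Plane) n).indicator (SimpleFunc.eapprox v n) x :=
    fun n x => SimpleFunc.restrict_apply _ measurableSet_ball x
  have hmono : ∀ x, Monotone fun n => f n x := by
    intro x n m hnm
    simp only [hfa]
    refine (Set.indicator_le_indicator (SimpleFunc.monotone_eapprox v hnm x)).trans ?_
    exact Set.indicator_le_indicator_of_subset (Metric.ball_subset_ball (by exact_mod_cast hnm))
      (fun _ => zero_le) x
  have hlim : ∀ x, Tendsto (fun n => f n x) atTop (𝓝 (v x)) := by
    intro x
    have h1 : Tendsto (fun n => SimpleFunc.eapprox v n x) atTop (𝓝 (v x)) :=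
      SimpleFunc.tendsto_eapprox hv x
    refine h1.congr' ?_
    obtain ⟨N, hN⟩ := exists_nat_gt ‖x‖
    filter_upwards [eventually_ge_atTop N] with n hn
    rw [hfa, Set.indicator_of_mem]
    simpa using hN.trans_le (by exact_mod_cast hn)
  have hfin : ∀ n y, y ≠ 0 → volume (f n ⁻¹' {y}) < ∞ := by
    intro n y hy
    refine (measure_mono ?_).trans_lt (measure_ball_lt_top (x := (0 : Plane)) (r := n))
    intro x hx
    by_contra h
    have : f n x = 0 := by rw [hfa, Set.indicator_of_notMem h]
    exact hy (by rw [← this]; exact hx.symm)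
  have hXm := hX.measurable_point
  have t1 := tendsto_lintegral_expNeg P (f := fun n ω => ∑' j, f n (X j ω))
    (g := fun ω => ∑' j, v (X j ω))
    (fun n => Measurable.tsum fun j => (f n).measurable.comp (hXm j))
    (by filter_upwards with ω using tendsto_tsum_of_monotone (fun j => hmono _) fun j => hlim _)
  have t2 := tendsto_lintegral_one_sub_expNeg volume (fun n => (f n).measurable) hmono hlim
  have t3 := (continuous_expNeg.tendsto _).comp
    (ENNReal.Tendsto.const_mul (a := ENNReal.ofReal lam) t2 (Or.inr ENNReal.ofReal_ne_top))
  refine tendsto_nhds_unique t1 (t3.congr fun n => ?_)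
  exact (hX.laplace_simpleFunc hlam (f n) (hfin n)).symm

end Laplace

/-! ### Squared norms in the plane and the law of the fading power -/

/-- A disc of squared radius `r` has area `π r`, linear in `r`, so the pushforward has constant
density. Stated for any such space in order to serve both `Plane` and `ℂ`. -/
lemma map_norm_sq_eq {E : Type*} [NormedAddCommGroup E] [MeasurableSpace E] [BorelSpace E]
    (μ : Measure E)
    (hμ : ∀ r, μ (Metric.ball (0 : E) r) = ENNReal.ofReal r ^ 2 * NNReal.pi) :
    μ.map (fun x => ‖x‖ ^ 2) = (NNReal.pi : ℝ≥0∞) • volume.restrict (Set.Ioi (0 : ℝ)) := by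
  have hm : Measurable fun x : E => ‖x‖ ^ 2 := by fun_prop
  have h1 : ∀ r, μ.map (fun x : E => ‖x‖ ^ 2) (Set.Iio r)
      = ENNReal.ofReal r * NNReal.pi := by
    intro r
    rw [Measure.map_apply hm measurableSet_Iio]
    have : (fun x : E => ‖x‖ ^ 2) ⁻¹' Set.Iio r = Metric.ball 0 (√r) := by
      ext x
      simp [Real.lt_sqrt (norm_nonneg x)]
    rw [this, hμ, ← ENNReal.ofReal_pow (Real.sqrt_nonneg r)]
    rcases le_total 0 r with hr | hr
    · rw [Real.sq_sqrt hr]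
    · rw [Real.sqrt_eq_zero_of_nonpos hr, ENNReal.ofReal_of_nonpos hr]; simp
  have h2 : ∀ r, ((NNReal.pi : ℝ≥0∞) • volume.restrict (Set.Ioi (0 : ℝ))) (Set.Iio r)
      = ENNReal.ofReal r * NNReal.pi := by
    intro r
    rw [Measure.smul_apply, Measure.restrict_apply measurableSet_Iio, Set.inter_comm,
      Set.Ioi_inter_Iio, Real.volume_Ioo, sub_zero, smul_eq_mul, mul_comm]
  have h3 : ∀ r : ℝ, ENNReal.ofReal r * NNReal.pi ≠ ∞ := fun r =>
    ENNReal.mul_ne_top ENNReal.ofReal_ne_top ENNReal.coe_ne_top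
  have h4 : ∀ a b : ℝ, Set.Ico a b = Set.Iio b \ Set.Iio a := by
    intro a b; ext; simp
  refine Measure.ext_of_Ico' _ _ (fun a b hab => ?_) fun a b hab => ?_
  · exact ne_top_of_le_ne_top (h1 b ▸ h3 b) (measure_mono Set.Ico_subset_Iio_self)
  · rw [h4, measure_sdiff (Set.Iio_subset_Iio hab.le) measurableSet_Iio.nullMeasurableSet
      (h1 a ▸ h3 a), measure_sdiff (Set.Iio_subset_Iio hab.le) measurableSet_Iio.nullMeasurableSet
      (h2 a ▸ h3 a), h1, h1, h2, h2]

lemma lintegral_norm_sq_plane {f : ℝ → ℝ≥0∞} (hf : Measurable f) :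
    ∫⁻ x : Plane, f (‖x‖ ^ 2) = NNReal.pi * ∫⁻ t in Set.Ioi 0, f t := by
  rw [← lintegral_map (g := fun x : Plane => ‖x‖ ^ 2) hf (by fun_prop), map_norm_sq_eq,
    lintegral_smul_measure, smul_eq_mul]
  intro r
  rw [EuclideanSpace.volume_ball_fin_two, ENNReal.ofReal_coe_nnreal.symm, NNReal.coe_real_pi]

lemma complexNormal_eq_withDensity :
    complexNormal = volume.withDensity
      fun z : ℂ => ENNReal.ofReal (Real.pi⁻¹ * Real.exp (-‖z‖ ^ 2)) := by
  have hv : (1 / 2 : ℝ≥0) ≠ 0 := by simp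
  have hd : Measurable fun z : ℂ => ENNReal.ofReal (Real.pi⁻¹ * Real.exp (-‖z‖ ^ 2)) := by fun_prop
  rw [complexNormal, gaussianReal_of_var_ne_zero _ hv,
    prod_withDensity (measurable_gaussianPDF _ _) (measurable_gaussianPDF _ _)]
  refine Measure.ext_of_lintegral _ fun f hf => ?_
  rw [lintegral_map hf (MeasurableEquiv.measurable _), lintegral_withDensity_eq_lintegral_mul _
    (by fun_prop) (g := fun p => f (Complex.measurableEquivRealProd.symm p))
    (hf.comp (MeasurableEquiv.measurable _)),
    lintegral_withDensity_eq_lintegral_mul _ hd hf,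
    ← (Complex.volume_preserving_equiv_real_prod.symm _).lintegral_comp (hd.mul hf)]
  refine lintegral_congr fun p => ?_
  simp only [Pi.mul_apply]
  congr 1
  rw [gaussianPDF, gaussianPDF, ← ENNReal.ofReal_mul (gaussianPDFReal_nonneg _ _ _)]
  congr 1
  have hn : ‖Complex.measurableEquivRealProd.symm p‖ ^ 2 = p.1 ^ 2 + p.2 ^ 2 := by
    rw [Complex.sq_norm, Complex.normSq_apply, Complex.measurableEquivRealProd_symm_apply]; ring
  have h5 : (2 * Real.pi * ((1 / 2 : ℝ≥0) : ℝ)) = Real.pi := by push_cast; ring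
  rw [hn, gaussianPDFReal, gaussianPDFReal, h5]
  rw [mul_mul_mul_comm, ← Real.exp_add, ← mul_inv, Real.mul_self_sqrt Real.pi_pos.le]
  congr 2
  push_cast
  ring

/-- `|h|²` is Exp(1): the density `π⁻¹ exp (-|z|²)` is radial, and `π⁻¹` cancels the `π` from the
area. -/
lemma lintegral_norm_sq_complexNormal {f : ℝ → ℝ≥0∞} (hf : Measurable f) :
    ∫⁻ z, f (‖z‖ ^ 2) ∂complexNormal
      = ∫⁻ t in Set.Ioi 0, f t * ENNReal.ofReal (Real.exp (-t)) := by
  rw [complexNormal_eq_withDensity, lintegral_withDensity_eq_lintegral_mul _ (by fun_prop)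
    (by fun_prop)]
  have h1 := lintegral_map (μ := (volume : Measure ℂ))
    (f := fun t => ENNReal.ofReal (Real.pi⁻¹ * Real.exp (-t)) * f t)
    (g := fun x : ℂ => ‖x‖ ^ 2) (by fun_prop) (by fun_prop)
  simp only [Pi.mul_apply]
  rw [← h1, map_norm_sq_eq _ (Complex.volume_ball 0), lintegral_smul_measure, smul_eq_mul,
    ← lintegral_const_mul _ (by fun_prop)]
  refine lintegral_congr fun t => ?_
  rw [← mul_assoc, mul_comm (f t)]
  congr 1
  rw [← ENNReal.ofReal_coe_nnreal, ← ENNReal.ofReal_mul (by positivity), NNReal.coe_real_pi,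
    mul_inv_cancel_left₀ Real.pi_ne_zero]

lemma lintegral_exp_neg_mul_Ioi {a : ℝ} (ha : 0 < a) (c : ℝ) :
    ∫⁻ t in Set.Ioi c, ENNReal.ofReal (Real.exp (-(a * t)))
      = ENNReal.ofReal (Real.exp (-(a * c)) / a) := by
  simp_rw [← neg_mul]
  rw [← ofReal_integral_eq_lintegral_ofReal (integrableOn_exp_mul_Ioi (neg_lt_zero.2 ha) c)
    (by filter_upwards with t using by positivity), integral_exp_mul_Ioi (neg_lt_zero.2 ha)]
  congr 1
  rw [neg_div_neg_eq]

/-- The exponential tail. Allowing `c = ∞` covers a divergent interference, which the signal never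
exceeds. -/
lemma complexNormal_norm_sq_gt (c : ℝ≥0∞) :
    complexNormal {z | c < ENNReal.ofReal (‖z‖ ^ 2)} = expNeg c := by
  have hs : MeasurableSet {t : ℝ | c < ENNReal.ofReal t} :=
    measurableSet_lt measurable_const ENNReal.measurable_ofReal
  have h := lintegral_norm_sq_complexNormal (f := {t : ℝ | c < ENNReal.ofReal t}.indicator 1)
    (measurable_one.indicator hs)
  have h1 : ∀ z : ℂ, {t : ℝ | c < ENNReal.ofReal t}.indicator (1 : ℝ → ℝ≥0∞) (‖z‖ ^ 2) =
      {z : ℂ | c < ENNReal.ofReal (‖z‖ ^ 2)}.indicator 1 z := fun z => rfl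
  simp_rw [h1] at h
  rw [lintegral_indicator_one (measurableSet_lt measurable_const (by fun_prop))] at h
  rw [h]
  rcases eq_or_ne c ∞ with rfl | hc
  · simp
  lift c to ℝ≥0 using hc
  rw [← ENNReal.ofReal_coe_nnreal, expNeg_ofReal c.coe_nonneg]
  have h2 := lintegral_exp_neg_mul_Ioi one_pos (c : ℝ)
  simp only [one_mul, div_one] at h2
  rw [← h2]
  have h3 : ∀ t : ℝ, {t : ℝ | ENNReal.ofReal c < ENNReal.ofReal t}.indicator (1 : ℝ → ℝ≥0∞) t *
      ENNReal.ofReal (Real.exp (-t))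
      = (Set.Ioi (c : ℝ)).indicator (fun t => ENNReal.ofReal (Real.exp (-t))) t := by
    intro t
    have : ENNReal.ofReal c < ENNReal.ofReal t ↔ (c : ℝ) < t := by
      rw [ENNReal.ofReal_lt_ofReal_iff']
      exact ⟨fun h => h.1, fun h => ⟨h, c.coe_nonneg.trans_lt h⟩⟩
    by_cases ht : (c : ℝ) < t
    · rw [Set.indicator_of_mem (by simpa [this] using ht), Set.indicator_of_mem (s := Set.Ioi (c : ℝ)) ht, Pi.one_apply,
        one_mul]
    · rw [Set.indicator_of_notMem (by simpa [this] using ht), Set.indicator_of_notMem (s := Set.Ioi (c : ℝ)) ht, zero_mul]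
  rw [lintegral_congr h3, lintegral_indicator measurableSet_Ioi,
    Measure.restrict_restrict measurableSet_Ioi, Set.inter_eq_left.2]
  exact Set.Ioi_subset_Ioi c.coe_nonneg

/-- The Laplace transform `1 / (1 + c)` of Exp(1), written with a logarithm so that products over
stations become sums in the exponent. -/
lemma complexNormal_expNeg {c : ℝ} (hc : 0 ≤ c) :
    ∫⁻ z, expNeg (ENNReal.ofReal (c * ‖z‖ ^ 2)) ∂complexNormal
      = expNeg (ENNReal.ofReal (Real.log (1 + c))) := by
  rw [lintegral_norm_sq_complexNormal (f := fun t => expNeg (ENNReal.ofReal (c * t)))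
    (by fun_prop), expNeg_ofReal (Real.log_nonneg (by linarith)), Real.exp_neg,
    Real.exp_log (by linarith)]
  have h2 := lintegral_exp_neg_mul_Ioi (a := 1 + c) (by linarith) 0
  simp only [mul_zero, neg_zero, Real.exp_zero, one_div] at h2
  rw [← h2]
  refine setLIntegral_congr_fun measurableSet_Ioi fun t ht => ?_
  rw [expNeg_ofReal (mul_nonneg hc (le_of_lt ht)), ← ENNReal.ofReal_mul (by positivity),
    ← Real.exp_add]
  ring_nf

/-! ### Thinning by interference and its expression through `ρ` -/

/-- The exponent of the interference factor `1 / (1 + s * (a / t) ^ b)` that a station at squared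
distance `t` contributes when the serving station is at squared distance `a`. -/
noncomputable def att (b s a t : ℝ) : ℝ≥0∞ := ENNReal.ofReal (Real.log (1 + s * (a / t) ^ b))

/-- The infinite potential on `(-∞, r)`. -/
noncomputable def cut (r t : ℝ) : ℝ≥0∞ := if t < r then ∞ else 0

/-- The probability that a station at squared distance `t > 0` with potential `att b s a` is
removed by thinning. -/
noncomputable def loss (b s a t : ℝ) : ℝ :=
  (Set.Ioi (0 : ℝ)).indicator (fun t => 1 - (1 + s * (a / t) ^ b)⁻¹) t

@[fun_prop] lemma measurable_cut (r : ℝ) : Measurable (cut r) :=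
  Measurable.ite measurableSet_Iio measurable_const measurable_const

@[fun_prop] lemma measurable_att (b s a : ℝ) : Measurable (att b s a) := by
  unfold att; fun_prop

lemma measurable_loss (b s a : ℝ) : Measurable (loss b s a) :=
  Measurable.indicator (by fun_prop) measurableSet_Ioi

section

variable {b s a t : ℝ}

lemma one_le_one_add_mul_rpow (hs : 0 ≤ s) (ha : 0 ≤ a) (ht : 0 ≤ t) :
    1 ≤ 1 + s * (a / t) ^ b := by
  have : 0 ≤ (a / t) ^ b := Real.rpow_nonneg (div_nonneg ha ht) b
  nlinarith [mul_nonneg hs this]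

lemma expNeg_att (hs : 0 ≤ s) (ha : 0 ≤ a) (ht : 0 ≤ t) :
    expNeg (att b s a t) = ENNReal.ofReal (1 + s * (a / t) ^ b)⁻¹ := by
  have h := one_le_one_add_mul_rpow (b := b) hs ha ht
  rw [att, expNeg_ofReal (Real.log_nonneg h), Real.exp_neg, Real.exp_log (by linarith)]

lemma loss_nonneg (hs : 0 ≤ s) (ha : 0 ≤ a) (t : ℝ) : 0 ≤ loss b s a t := by
  refine Set.indicator_nonneg (fun t ht => ?_) t
  have h := one_le_one_add_mul_rpow (b := b) hs ha (le_of_lt ht)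
  exact sub_nonneg.2 (inv_le_one_of_one_le₀ h)

lemma loss_le_one (hs : 0 ≤ s) (ha : 0 ≤ a) (t : ℝ) : loss b s a t ≤ 1 := by
  unfold loss
  by_cases ht : t ∈ Set.Ioi (0 : ℝ)
  · rw [Set.indicator_of_mem ht]
    have h := one_le_one_add_mul_rpow (b := b) hs ha (le_of_lt ht)
    have : 0 ≤ (1 + s * (a / t) ^ b)⁻¹ := by positivity
    linarith
  · rw [Set.indicator_of_notMem ht]; exact zero_le_one

lemma loss_le_rpow (hs : 0 ≤ s) (ha : 0 ≤ a) (ht : 0 < t) :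
    loss b s a t ≤ s * a ^ b * t ^ (-b) := by
  rw [loss, Set.indicator_of_mem (Set.mem_Ioi.2 ht)]
  have h := one_le_one_add_mul_rpow (b := b) hs ha ht.le
  have h1 : s * (a / t) ^ b = s * a ^ b * t ^ (-b) := by
    rw [Real.div_rpow ha ht.le, Real.rpow_neg ht.le]; ring
  rw [← h1]
  have h2 : 1 - s * (a / t) ^ b ≤ (1 + s * (a / t) ^ b)⁻¹ := by
    rw [← one_div, le_div_iff₀ (by linarith)]
    nlinarith [sq_nonneg (s * (a / t) ^ b)]
  linarith

/-- Bounded by 1 near 0 and by a multiple of `t ^ (-b)` at infinity. With `b = α / 2`, the condition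
`1 < b` is `α > 2`. -/
lemma integrable_loss (hb : 1 < b) (hs : 0 ≤ s) (ha : 0 ≤ a) : Integrable (loss b s a) := by
  have h0 : loss b s a = (Set.Ioi (0 : ℝ)).indicator (loss b s a) := by
    unfold loss; rw [Set.indicator_indicator, Set.inter_self]
  rw [h0, integrable_indicator_iff measurableSet_Ioi, ← Set.Ioc_union_Ioi_eq_Ioi zero_le_one]
  refine IntegrableOn.union ?_ ?_
  · refine Measure.integrableOn_of_bounded (M := 1) (by simp)
      (measurable_loss b s a).aestronglyMeasurable ?_
    filter_upwards with t
    rw [Real.norm_of_nonneg (loss_nonneg hs ha t)]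
    exact loss_le_one hs ha t
  · refine Integrable.mono' (((integrableOn_Ioi_rpow_of_lt (a := -b) (by linarith) one_pos)).const_mul
      (s * a ^ b)) (measurable_loss b s a).aestronglyMeasurable ?_
    filter_upwards [self_mem_ae_restrict measurableSet_Ioi] with t ht
    rw [Real.norm_of_nonneg (loss_nonneg hs ha t)]
    exact loss_le_rpow hs ha (zero_lt_one.trans ht)

lemma continuousAt_loss (ht : 0 < t) (hs : 0 ≤ s) (ha : 0 ≤ a) (hb : 0 < b) :
    ContinuousAt (loss b s a) t := by
  have h1 : ContinuousAt (fun t => 1 - (1 + s * (a / t) ^ b)⁻¹) t := by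
    have h := one_le_one_add_mul_rpow (b := b) hs ha ht.le
    refine continuousAt_const.sub (ContinuousAt.inv₀ ?_ (by linarith))
    refine continuousAt_const.add (continuousAt_const.mul ?_)
    exact (continuousAt_const.div continuousAt_id ht.ne').rpow_const (Or.inr hb.le)
  refine h1.congr ?_
  filter_upwards [Ioi_mem_nhds ht] with x hx
  rw [loss, Set.indicator_of_mem hx]

/-- The mean number of stations lost, per unit density, when the stations closer than `r` are
removed and the others are thinned by `att b s a`. -/
noncomputable def lossMass (b s a r : ℝ) : ℝ := r + ∫ t in Set.Ioi r, loss b s a t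

/-- Moves `r` into an interval integral, to which the fundamental theorem of calculus applies. -/
lemma lossMass_eq (hb : 1 < b) (hs : 0 ≤ s) (ha : 0 ≤ a) (r : ℝ) :
    lossMass b s a r = r + ((∫ t in Set.Ioi 0, loss b s a t) - ∫ t in (0 : ℝ)..r, loss b s a t) := by
  have h := integrable_loss hb hs ha
  rw [lossMass, ← intervalIntegral.integral_Ioi_sub_Ioi' h.integrableOn h.integrableOn]
  ring

lemma le_lossMass (hs : 0 ≤ s) (ha : 0 ≤ a) (r : ℝ) : r ≤ lossMass b s a r :=
  le_add_of_nonneg_right (integral_nonneg fun t => loss_nonneg hs ha t)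

lemma continuous_lossMass (hb : 1 < b) (hs : 0 ≤ s) (ha : 0 ≤ a) :
    Continuous (lossMass b s a) := by
  rw [funext (lossMass_eq hb hs ha)]
  exact continuous_id.add (continuous_const.sub
    (intervalIntegral.continuous_primitive (fun _ _ => (integrable_loss hb hs ha).intervalIntegrable) 0))

lemma hasDerivAt_lossMass (hb : 1 < b) (hs : 0 ≤ s) (ha : 0 ≤ a) (ht : 0 < t) :
    HasDerivAt (lossMass b s a) (1 + s * (a / t) ^ b)⁻¹ t := by
  rw [funext (lossMass_eq hb hs ha)]
  have h := intervalIntegral.integral_hasDerivAt_right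
    ((integrable_loss hb hs ha).intervalIntegrable (a := 0) (b := t))
    (measurable_loss b s a).stronglyMeasurable.stronglyMeasurableAtFilter
    (continuousAt_loss ht hs ha (by linarith))
  have h2 := (hasDerivAt_id t).add ((hasDerivAt_const t (∫ t in Set.Ioi 0, loss b s a t)).sub h)
  refine h2.congr_deriv ?_
  rw [loss, Set.indicator_of_mem (Set.mem_Ioi.2 ht)]
  ring

lemma lintegral_one_sub_expNeg_cut_add_att (hb : 1 < b) (hs : 0 ≤ s) (ha : 0 ≤ a) {r : ℝ}
    (hr : 0 ≤ r) :
    ∫⁻ t in Set.Ioi 0, (1 - expNeg (cut r t + att b s a t))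
      = ENNReal.ofReal (lossMass b s a r) := by
  rw [← lintegral_inter_add_sdiff _ (Set.Ioi 0) (measurableSet_Iio (a := r))]
  have h1 : ∫⁻ t in Set.Ioi 0 ∩ Set.Iio r, (1 - expNeg (cut r t + att b s a t))
      = ENNReal.ofReal r := by
    rw [setLIntegral_congr_fun (g := fun _ => 1) (measurableSet_Ioi.inter measurableSet_Iio),
      setLIntegral_one, Set.Ioi_inter_Iio, Real.volume_Ioo, sub_zero]
    intro t ht
    simp [cut, show t < r from ht.2]
  have h2 : ∫⁻ t in Set.Ioi 0 \ Set.Iio r, (1 - expNeg (cut r t + att b s a t))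
      = ENNReal.ofReal (∫ t in Set.Ioi r, loss b s a t) := by
    rw [ofReal_integral_eq_lintegral_ofReal (integrable_loss hb hs ha).integrableOn
      (by filter_upwards with t using loss_nonneg hs ha t)]
    have h3 : (Set.Ioi 0 \ Set.Iio r : Set ℝ) =ᵐ[volume] Set.Ioi r := by
      refine EventuallyLE.antisymm ?_ ?_
      · have : (Set.Ioi 0 \ Set.Iio r : Set ℝ) ⊆ Set.Ici r := fun t ht => Set.notMem_Iio.1 ht.2
        exact (LE.le.eventuallyLE this).trans Ioi_ae_eq_Ici.symm.le
      · exact LE.le.eventuallyLE fun t (ht : r < t) =>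
          ⟨hr.trans_lt ht, Set.notMem_Iio.2 ht.le⟩
    rw [setLIntegral_congr h3]
    refine setLIntegral_congr_fun measurableSet_Ioi fun t ht => ?_
    have ht0 : 0 < t := hr.trans_lt ht
    have hrt : ¬ t < r := not_lt.2 (Set.mem_Ioi.1 ht).le
    simp only [cut, if_neg hrt, zero_add]
    rw [expNeg_att hs ha ht0.le, loss, Set.indicator_of_mem (Set.mem_Ioi.2 ht0),
      ENNReal.ofReal_sub _ (by have := one_le_one_add_mul_rpow (b := b) hs ha ht0.le; positivity),
      ENNReal.ofReal_one]
  rw [h1, h2, ← ENNReal.ofReal_add hr (integral_nonneg fun t => loss_nonneg hs ha t)]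
  rfl

/-- The integrand is the derivative of `-exp (-c * lossMass)`, which tends to 0 because `lossMass b
s a t ≥ t`. This turns a tail probability of the nearest distance into a density. -/
lemma lintegral_deriv_exp_lossMass (hb : 1 < b) (hs : 0 ≤ s) (ha : 0 ≤ a) {c : ℝ} (hc : 0 < c)
    {r : ℝ} (hr : 0 ≤ r) :
    ∫⁻ t in Set.Ioi r,
        ENNReal.ofReal (c * (1 + s * (a / t) ^ b)⁻¹ * Real.exp (-(c * lossMass b s a t)))
      = ENNReal.ofReal (Real.exp (-(c * lossMass b s a r))) := by
  have hd : ∀ t ∈ Set.Ioi r, HasDerivAt (fun t => -Real.exp (-(c * lossMass b s a t)))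
      (c * (1 + s * (a / t) ^ b)⁻¹ * Real.exp (-(c * lossMass b s a t))) t := by
    intro t ht
    have h := ((hasDerivAt_lossMass hb hs ha (hr.trans_lt ht)).const_mul c).neg.exp.neg
    refine h.congr_deriv ?_
    simp only [Pi.neg_apply]
    ring
  have hpos : ∀ t ∈ Set.Ioi r,
      0 ≤ c * (1 + s * (a / t) ^ b)⁻¹ * Real.exp (-(c * lossMass b s a t)) := by
    intro t ht
    have := one_le_one_add_mul_rpow (b := b) hs ha (hr.trans (le_of_lt ht))
    positivity
  have hlim : Tendsto (fun t => -Real.exp (-(c * lossMass b s a t))) atTop (𝓝 0) := by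
    rw [← neg_zero]
    refine Tendsto.neg (Real.tendsto_exp_neg_atTop_nhds_zero.comp ?_)
    exact (tendsto_atTop_mono (fun t => le_lossMass hs ha t) tendsto_id).const_mul_atTop hc
  have hcont : ContinuousWithinAt (fun t => -Real.exp (-(c * lossMass b s a t))) (Set.Ici r) r := by
    have := continuous_lossMass hb hs ha
    exact Continuous.continuousWithinAt (by fun_prop)
  rw [← ofReal_integral_eq_lintegral_ofReal (integrableOn_Ioi_deriv_of_nonneg hcont hd hpos hlim)
    (by filter_upwards [self_mem_ae_restrict measurableSet_Ioi] with t ht using hpos t ht),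
    integral_Ioi_of_hasDerivAt_of_nonneg hcont hd hpos hlim]
  simp

end

/-- The prefactor `0 ^ (2 / α)` makes the integrand vanish, whatever the lower limit is. -/
lemma rho_zero {α : ℝ} (hα : 0 < α) : rho 0 α = 0 := by
  have : (2 / α) ≠ 0 := by positivity
  simp [rho, Real.zero_rpow this]

/-- The loss depends only on `a / t`, so the mass is linear in `a`. The substitution `t = a * s ^
b⁻¹ * u` turns the integral into that of `ρ`. -/
lemma lossMass_mul_self {b s a κ : ℝ} (hb : 1 < b) (hs : 0 ≤ s) (ha : 0 < a) (hκ : 0 < κ) :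
    lossMass b s a (κ * a) = κ * a * (1 + rho (s / κ ^ b) (2 * b)) := by
  rw [lossMass, mul_add, mul_one]
  congr 1
  have hb0 : b ≠ 0 := by linarith
  rcases hs.eq_or_lt with rfl | hs
  · rw [zero_div, rho_zero (by linarith), mul_zero]
    exact integral_eq_zero_of_ae (by filter_upwards with t using by simp [loss])
  have e1 : 2 / (2 * b) = b⁻¹ := by field_simp
  have e2 : -2 / (2 * b) = -b⁻¹ := by field_simp
  have hd : (s / κ ^ b) ^ b⁻¹ = s ^ b⁻¹ / κ := by
    rw [Real.div_rpow hs.le (by positivity), Real.rpow_rpow_inv hκ.le hb0]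
  have hsb : 0 < s ^ b⁻¹ := by positivity
  have hB : 0 < a * s ^ b⁻¹ := by positivity
  have h := integral_comp_mul_left_Ioi (loss b s a) (κ / s ^ b⁻¹) hB
  have e3 : a * s ^ b⁻¹ * (κ / s ^ b⁻¹) = κ * a := by field_simp
  rw [e3, eq_comm, smul_eq_mul, inv_mul_eq_iff_eq_mul₀ hB.ne'] at h
  rw [h, rho, e1, e2, Real.rpow_neg (by positivity), hd, inv_div]
  have e4 : 2 * b / 2 = b := by ring
  simp_rw [e4, div_eq_mul_inv (s ^ b⁻¹ / κ)]
  rw [integral_const_mul]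
  have e5 : κ * a * (s ^ b⁻¹ / κ * ∫ u in Set.Ioi (κ / s ^ b⁻¹), (1 + u ^ b)⁻¹)
    = a * s ^ b⁻¹ * ∫ u in Set.Ioi (κ / s ^ b⁻¹), (1 + u ^ b)⁻¹ := by field_simp
  rw [e5]
  congr 1
  refine setIntegral_congr_fun measurableSet_Ioi fun u hu => ?_
  have hu0 : 0 < u := lt_trans (by positivity) hu
  have hub : 0 < u ^ b := by positivity
  rw [loss, Set.indicator_of_mem (Set.mem_Ioi.2 (by positivity))]
  have e6 : a / (a * s ^ b⁻¹ * u) = (s ^ b⁻¹ * u)⁻¹ := by field_simp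
  rw [e6, Real.inv_rpow (by positivity), Real.mul_rpow hsb.le hu0.le, Real.rpow_inv_rpow hs.le hb0]
  field_simp
  ring

/-! ### Half-line processes and dyadic approximation -/

/-- `T 0, T 1, …` are nonnegative random variables with the Laplace functional of a homogeneous
Poisson point process of density `c` on the half-line. -/
structure IsHalfLinePPP {Ω : Type*} [MeasurableSpace Ω] (P : Measure Ω) (c : ℝ)
    (T : ℕ → Ω → ℝ) : Prop where
  measurable_point : ∀ n, Measurable (T n)
  nonneg : ∀ n ω, 0 ≤ T n ω
  laplace : ∀ v : ℝ → ℝ≥0∞, Measurable v → ∫⁻ ω, expNeg (∑' n, v (T n ω)) ∂P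
    = expNeg (ENNReal.ofReal c * ∫⁻ t in Set.Ioi 0, (1 - expNeg (v t)))

/-- The largest multiple of `2⁻ᵐ` below `t`. -/
noncomputable def dyadicFloor (m : ℕ) (t : ℝ) : ℝ := (⌊2 ^ m * t⌋₊ : ℝ) / 2 ^ m

lemma dyadicFloor_nonneg (m : ℕ) (t : ℝ) : 0 ≤ dyadicFloor m t := by
  unfold dyadicFloor; positivity

lemma dyadicFloor_le (m : ℕ) {t : ℝ} (ht : 0 ≤ t) : dyadicFloor m t ≤ t := by
  rw [dyadicFloor, div_le_iff₀ (by positivity), mul_comm t]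
  exact Nat.floor_le (by positivity)

lemma monotone_dyadicFloor {t : ℝ} (ht : 0 ≤ t) : Monotone fun m => dyadicFloor m t := by
  refine monotone_nat_of_le_succ fun m => ?_
  rw [dyadicFloor, dyadicFloor, div_le_div_iff₀ (by positivity) (by positivity)]
  have h : 2 * ⌊2 ^ m * t⌋₊ ≤ ⌊2 ^ (m + 1) * t⌋₊ := by
    refine Nat.le_floor ?_
    push_cast
    have := Nat.floor_le (show 0 ≤ 2 ^ m * t by positivity)
    rw [pow_succ]; linarith
  rw [pow_succ] at h ⊢
  have h' : (2 * ⌊2 ^ m * t⌋₊ : ℝ) ≤ ⌊2 ^ m * 2 * t⌋₊ := by exact_mod_cast h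
  nlinarith [show (0 : ℝ) < 2 ^ m by positivity]

lemma tendsto_dyadicFloor {t : ℝ} (ht : 0 ≤ t) :
    Tendsto (fun m => dyadicFloor m t) atTop (𝓝 t) := by
  have h := (tendsto_nat_floor_mul_div_atTop (R := ℝ) ht).comp
    (tendsto_pow_atTop_atTop_of_one_lt (one_lt_two (α := ℝ)))
  refine h.congr fun m => ?_
  simp [dyadicFloor, mul_comm]

section

variable {b s : ℝ}

lemma att_mono (hb : 0 < b) (hs : 0 ≤ s) {a a' t : ℝ} (ha : 0 ≤ a) (haa : a ≤ a') (ht : 0 ≤ t) :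
    att b s a t ≤ att b s a' t := by
  refine ENNReal.ofReal_le_ofReal (Real.log_le_log ?_ ?_)
  · linarith [one_le_one_add_mul_rpow (b := b) hs ha ht]
  · gcongr

lemma continuous_att (hb : 0 < b) (hs : 0 ≤ s) {a t : ℝ} (ha : 0 ≤ a) (ht : 0 ≤ t) :
    ContinuousAt (fun a => att b s a t) a := by
  have h : ContinuousAt (fun a => 1 + s * (a / t) ^ b) a :=
    continuousAt_const.add (continuousAt_const.mul
      ((continuousAt_id.div_const t).rpow_const (Or.inr hb.le)))
  exact ENNReal.continuous_ofReal.continuousAt.comp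
    (h.log (by linarith [one_le_one_add_mul_rpow (b := b) hs ha ht]))

lemma cut_mono {r r' : ℝ} (h : r ≤ r') (t : ℝ) : cut r t ≤ cut r' t := by
  unfold cut
  by_cases ht : t < r
  · simp [ht, ht.trans_le h]
  · simp [ht]

/-- `cut` is only left-continuous in `r`, which is why the reference distance is approximated from
below. The sequence is eventually constant. -/
lemma tendsto_cut {r : ℕ → ℝ} {r' : ℝ} (hle : ∀ n, r n ≤ r') (h : Tendsto r atTop (𝓝 r'))
    (t : ℝ) : Tendsto (fun n => cut (r n) t) atTop (𝓝 (cut r' t)) := by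
  refine tendsto_const_nhds.congr' ?_
  unfold cut
  by_cases ht : t < r'
  · filter_upwards [h.eventually (lt_mem_nhds ht)] with n hn
    simp [ht, hn]
  · filter_upwards with n
    simp [ht, (hle n).trans (not_lt.1 ht)]

/-- The mean number of stations lost in `ℝ≥0∞`, as it occurs in the Laplace functional. -/
noncomputable def elossMass (b s a r : ℝ) : ℝ≥0∞ :=
  ∫⁻ t in Set.Ioi 0, (1 - expNeg (cut r t + att b s a t))

lemma ofReal_le_elossMass (hb : 1 < b) (hs : 0 ≤ s) {a r : ℝ} (ha : 0 ≤ a) (hr : 0 ≤ r) :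
    ENNReal.ofReal r ≤ elossMass b s a r := by
  rw [elossMass, lintegral_one_sub_expNeg_cut_add_att hb hs ha hr]
  exact ENNReal.ofReal_le_ofReal (le_lossMass hs ha r)

lemma tendsto_elossMass (hb : 0 < b) (hs : 0 ≤ s) {a r : ℕ → ℝ} {a' r' : ℝ} (ha : ∀ n, 0 ≤ a n)
    (ham : Monotone a) (hal : Tendsto a atTop (𝓝 a')) (hrm : Monotone r)
    (hrl : Tendsto r atTop (𝓝 r')) :
    Tendsto (fun n => elossMass b s (a n) (r n)) atTop (𝓝 (elossMass b s a' r')) := by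
  have ha' : 0 ≤ a' := ge_of_tendsto' hal ha
  refine lintegral_tendsto_of_tendsto_of_monotone (fun n => by fun_prop) ?_ ?_
  · filter_upwards [self_mem_ae_restrict measurableSet_Ioi] with t ht n m hnm
    exact tsub_le_tsub_left (expNeg_antitone
      (add_le_add (cut_mono (hrm hnm) t) (att_mono hb hs (ha n) (ham hnm) (le_of_lt ht)))) 1
  · filter_upwards [self_mem_ae_restrict measurableSet_Ioi] with t ht
    refine ENNReal.Tendsto.sub tendsto_const_nhds ((continuous_expNeg.tendsto _).comp ?_)
      (Or.inl (by simp))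
    exact (tendsto_cut (hrm.ge_of_tendsto hrl) hrl t).add
      ((continuous_att hb hs ha' (le_of_lt ht)).tendsto.comp hal)

lemma measurable_expNeg_tsum {f : ℝ → ℝ≥0∞} (hf : Measurable f) :
    Measurable fun x : ℕ → ℝ => expNeg (∑' n, f (x n)) :=
  measurable_expNeg.comp (Measurable.tsum fun n => hf.comp (measurable_pi_apply n))

end

/-! ### Averaging over the nearest station -/

/-- The sub-density of the squared distance `t` to the serving station, weighted by the
interference factors computed for a serving station at squared distance `a`. -/
noncomputable def nearestDensity (b s₁ s₂ κ c₁ c₂ a t : ℝ) : ℝ≥0∞ :=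
  ENNReal.ofReal c₁ * expNeg (att b s₁ a t) * expNeg (ENNReal.ofReal c₁ * elossMass b s₁ a t)
    * expNeg (ENNReal.ofReal c₂ * elossMass b s₂ a (κ * a))

section Nearest

variable {Ω : Type*} [MeasurableSpace Ω] {P : Measure Ω}
  {b s₁ s₂ κ c₁ c₂ : ℝ} {T U : ℕ → Ω → ℝ} {M : Ω → ℝ}

/-- The total potential of both tiers for a serving station at squared distance `a`; it is
infinite if a station of the second tier has squared distance below `κ * a`. -/
noncomputable def potential (b s₁ s₂ κ : ℝ) (T U : ℕ → Ω → ℝ) (a : ℝ) (ω : Ω) : ℝ≥0∞ :=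
  (∑' n, att b s₁ a (T n ω)) + ∑' m, (cut (κ * a) (U m ω) + att b s₂ a (U m ω))

lemma measurable_potential (hT : ∀ n, Measurable (T n)) (hU : ∀ n, Measurable (U n)) {a : Ω → ℝ}
    (ha : Measurable a) : Measurable fun ω => potential b s₁ s₂ κ T U (a ω) ω := by
  unfold potential
  refine Measurable.add (Measurable.tsum fun n => ?_) (Measurable.tsum fun n => Measurable.add ?_ ?_)
  · have := hT n
    unfold att; fun_prop
  · exact Measurable.ite (measurableSet_lt (hU n) (ha.const_mul κ)) measurable_const measurable_const
  · have := hU n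
    unfold att; fun_prop

lemma expNeg_tsum_cut {x : ℕ → ℝ} {m : ℝ} (hm : IsLeast (Set.range x) m) (r : ℝ) :
    expNeg (∑' n, cut r (x n)) = (Set.Ici r).indicator 1 m := by
  by_cases h : r ≤ m
  · have : ∀ n, cut r (x n) = 0 := fun n =>
      if_neg (not_lt.2 (h.trans (hm.2 (Set.mem_range_self n))))
    simp [this, h]
  · obtain ⟨n, hn⟩ := hm.1
    have : ∑' n, cut r (x n) = ∞ := by
      refine ENNReal.tsum_eq_top_of_eq_top ⟨n, if_pos ?_⟩
      rw [hn]; exact not_le.1 h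
    simp [this, h]

/-- With `a` frozen, the event `r ≤ M` is the infinite potential `cut r` on the first tier.
Independence separates the tiers, each factor is a Laplace functional, and the first one is the
integral of minus its derivative in `r`. -/
lemma lintegral_Ici_potential (hb : 1 < b) (hs₁ : 0 ≤ s₁) (hc₁ : 0 < c₁)
    (hT : IsHalfLinePPP P c₁ T) (hU : IsHalfLinePPP P c₂ U)
    (hTU : IndepFun (fun ω n => T n ω) (fun ω n => U n ω) P)
    (hM : ∀ᵐ ω ∂P, IsLeast (Set.range fun n => T n ω) (M ω)) {a r : ℝ} (ha : 0 ≤ a) (hr : 0 ≤ r) :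
    ∫⁻ ω, (Set.Ici r).indicator 1 (M ω) * expNeg (potential b s₁ s₂ κ T U a ω) ∂P
      = ∫⁻ t in Set.Ioi r, nearestDensity b s₁ s₂ κ c₁ c₂ a t := by
  have h1 : ∫⁻ ω, (Set.Ici r).indicator 1 (M ω) * expNeg (potential b s₁ s₂ κ T U a ω) ∂P
      = ∫⁻ ω, expNeg (∑' n, (cut r (T n ω) + att b s₁ a (T n ω))) *
          expNeg (∑' m, (cut (κ * a) (U m ω) + att b s₂ a (U m ω))) ∂P := by
    refine lintegral_congr_ae ?_
    filter_upwards [hM] with ω hω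
    rw [ENNReal.tsum_add (f := fun n => cut r (T n ω)), expNeg_add, expNeg_tsum_cut hω, potential,
      expNeg_add, mul_assoc]
  have h2 := lintegral_mul_eq_lintegral_mul_lintegral_of_indepFun
    (f := fun ω => expNeg (∑' n, (cut r (T n ω) + att b s₁ a (T n ω))))
    (g := fun ω => expNeg (∑' m, (cut (κ * a) (U m ω) + att b s₂ a (U m ω)))) (μ := P)
    ((measurable_expNeg_tsum (f := fun t => cut r t + att b s₁ a t) (by fun_prop)).comp
      (measurable_pi_lambda _ hT.measurable_point))
    ((measurable_expNeg_tsum (f := fun t => cut (κ * a) t + att b s₂ a t) (by fun_prop)).comp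
      (measurable_pi_lambda _ hU.measurable_point))
    (hTU.comp (measurable_expNeg_tsum (f := fun t => cut r t + att b s₁ a t) (by fun_prop))
      (measurable_expNeg_tsum (f := fun t => cut (κ * a) t + att b s₂ a t) (by fun_prop)))
  simp only [Pi.mul_apply] at h2
  rw [h1, h2, hT.laplace (fun t => cut r t + att b s₁ a t) (by fun_prop),
    hU.laplace (fun t => cut (κ * a) t + att b s₂ a t) (by fun_prop)]
  unfold nearestDensity
  rw [lintegral_mul_const' _ _ (expNeg_ne_top _), elossMass]
  congr 1
  have hle := fun t => le_lossMass (b := b) hs₁ ha t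
  rw [lintegral_one_sub_expNeg_cut_add_att hb hs₁ ha hr, ← ENNReal.ofReal_mul hc₁.le,
    expNeg_ofReal (mul_nonneg hc₁.le (hr.trans (hle r))),
    ← lintegral_deriv_exp_lossMass hb hs₁ ha hc₁ hr]
  refine setLIntegral_congr_fun measurableSet_Ioi fun t ht => ?_
  have ht0 : 0 ≤ t := hr.trans (le_of_lt ht)
  have := one_le_one_add_mul_rpow (b := b) hs₁ ha ht0
  simp only [elossMass]
  rw [lintegral_one_sub_expNeg_cut_add_att hb hs₁ ha ht0, ← ENNReal.ofReal_mul hc₁.le,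
    expNeg_ofReal (mul_nonneg hc₁.le (ht0.trans (hle t))), expNeg_att hs₁ ha ht0,
    ← ENNReal.ofReal_mul hc₁.le, ← ENNReal.ofReal_mul (by positivity)]

lemma measurable_nearestDensity (hb : 1 < b) (hs₁ : 0 ≤ s₁) {a : ℝ} (ha : 0 ≤ a) :
    AEMeasurable (nearestDensity b s₁ s₂ κ c₁ c₂ a) (volume.restrict (Set.Ioi 0)) := by
  unfold nearestDensity
  refine AEMeasurable.mul_const (AEMeasurable.mul (by fun_prop) ?_) _
  refine measurable_expNeg.comp_aemeasurable (AEMeasurable.const_mul ?_ _)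
  refine AEMeasurable.congr (f := fun t => ENNReal.ofReal (lossMass b s₁ a t)) ?_ ?_
  · exact (continuous_lossMass hb hs₁ ha).measurable.ennreal_ofReal.aemeasurable
  · filter_upwards [self_mem_ae_restrict measurableSet_Ioi] with t ht
    exact (lintegral_one_sub_expNeg_cut_add_att hb hs₁ ha (le_of_lt ht)).symm

/-- Both sides are measures of `S`, the left one finite. By the preceding tail formula they agree on
all half-lines `Ici r`, hence everywhere. -/
lemma lintegral_indicator_potential [IsProbabilityMeasure P] (hb : 1 < b) (hs₁ : 0 ≤ s₁)
    (hc₁ : 0 < c₁) (hT : IsHalfLinePPP P c₁ T) (hU : IsHalfLinePPP P c₂ U)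
    (hTU : IndepFun (fun ω n => T n ω) (fun ω n => U n ω) P) (hMm : Measurable M)
    (hM : ∀ᵐ ω ∂P, IsLeast (Set.range fun n => T n ω) (M ω)) {a : ℝ} (ha : 0 ≤ a) {S : Set ℝ}
    (hS : MeasurableSet S) :
    ∫⁻ ω, S.indicator 1 (M ω) * expNeg (potential b s₁ s₂ κ T U a ω) ∂P
      = ∫⁻ t in Set.Ioi 0, S.indicator 1 t * nearestDensity b s₁ s₂ κ c₁ c₂ a t := by
  set Z : Ω → ℝ≥0∞ := fun ω => expNeg (potential b s₁ s₂ κ T U a ω)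
  have hZm : Measurable Z := measurable_expNeg.comp
    (measurable_potential hT.measurable_point hU.measurable_point measurable_const)
  have l1 : ∀ S : Set ℝ, MeasurableSet S →
      (P.withDensity Z).map M S = ∫⁻ ω, S.indicator 1 (M ω) * Z ω ∂P := by
    intro S hS
    rw [Measure.map_apply hMm hS, withDensity_apply _ (hMm hS), ← lintegral_indicator (hMm hS)]
    refine lintegral_congr fun ω => ?_
    by_cases h : M ω ∈ S <;> simp [h]
  have l2 : ∀ S : Set ℝ, MeasurableSet S →
      ((volume.restrict (Set.Ioi 0)).withDensity (nearestDensity b s₁ s₂ κ c₁ c₂ a)) S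
        = ∫⁻ t in Set.Ioi 0, S.indicator 1 t * nearestDensity b s₁ s₂ κ c₁ c₂ a t := by
    intro S hS
    rw [withDensity_apply _ hS, ← lintegral_indicator hS]
    refine lintegral_congr fun t => ?_
    by_cases h : t ∈ S <;> simp [h]
  have hfin : IsFiniteMeasure ((P.withDensity Z).map M) := by
    refine ⟨?_⟩
    rw [Measure.map_apply hMm MeasurableSet.univ, Set.preimage_univ,
      withDensity_apply _ MeasurableSet.univ, Measure.restrict_univ]
    calc ∫⁻ ω, Z ω ∂P ≤ ∫⁻ _, 1 ∂P := lintegral_mono fun ω => expNeg_le_one _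
      _ < ∞ := by simp
  have key : (P.withDensity Z).map M =
      (volume.restrict (Set.Ioi 0)).withDensity (nearestDensity b s₁ s₂ κ c₁ c₂ a) := by
    refine Measure.ext_of_Ici _ _ fun r => ?_
    rw [l1 _ measurableSet_Ici]
    -- The tail formula needs `0 ≤ r`; a negative `r` may be replaced by 0 because `M ≥ 0` almost
    -- surely.
    have h3 := lintegral_Ici_potential (s₂ := s₂) (κ := κ) hb hs₁ hc₁ hT hU hTU hM ha
      (le_max_right r 0)
    have h4 : ∀ᵐ ω ∂P, (Set.Ici r).indicator 1 (M ω) * Z ω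
        = (Set.Ici (max r 0)).indicator 1 (M ω) * Z ω := by
      filter_upwards [hM] with ω hω
      have h0 : 0 ≤ M ω := by
        obtain ⟨n, hn⟩ := hω.1
        rw [← hn]; exact hT.nonneg n ω
      simp [Set.indicator_apply, h0]
    rw [lintegral_congr_ae h4, h3, withDensity_apply _ measurableSet_Ici,
      Measure.restrict_restrict measurableSet_Ici]
    refine setLIntegral_congr ?_
    rcases le_total r 0 with h | h
    · have : (Set.Ici r ∩ Set.Ioi 0 : Set ℝ) = Set.Ioi 0 :=
        Set.inter_eq_right.2 fun t (ht : 0 < t) => h.trans ht.le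
      rw [max_eq_right h, this]
      exact EventuallyEq.rfl
    · rw [max_eq_left h]
      have : (Set.Ioi r ∩ Set.Ioi 0 : Set ℝ) = Set.Ioi r :=
        Set.inter_eq_left.2 (Set.Ioi_subset_Ioi h)
      rw [← this]
      exact Ioi_ae_eq_Ici.inter (ae_eq_refl _)
  rw [← l1 S hS, ← l2 S hS, key]

/-- On each dyadic cell the reference distance is constant, so the frozen identity applies cell by
cell and can be summed. -/
lemma lintegral_potential_dyadicFloor [IsProbabilityMeasure P] (hb : 1 < b) (hs₁ : 0 ≤ s₁)
    (hc₁ : 0 < c₁) (hT : IsHalfLinePPP P c₁ T) (hU : IsHalfLinePPP P c₂ U)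
    (hTU : IndepFun (fun ω n => T n ω) (fun ω n => U n ω) P) (hMm : Measurable M)
    (hM : ∀ᵐ ω ∂P, IsLeast (Set.range fun n => T n ω) (M ω)) (m : ℕ) :
    ∫⁻ ω, expNeg (potential b s₁ s₂ κ T U (dyadicFloor m (M ω)) ω) ∂P
      = ∫⁻ t in Set.Ioi 0, nearestDensity b s₁ s₂ κ c₁ c₂ (dyadicFloor m t) t := by
  have hfl : Measurable fun t : ℝ => ⌊2 ^ m * t⌋₊ := by fun_prop
  let S : ℕ → Set ℝ := fun j => {t | ⌊2 ^ m * t⌋₊ = j}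
  have hS : ∀ j, MeasurableSet (S j) := fun j => hfl (measurableSet_singleton j)
  have hsum : ∀ (f : ℝ → ℝ≥0∞) (t : ℝ), f (dyadicFloor m t)
      = ∑' j : ℕ, (S j).indicator 1 t * f ((j : ℝ) / 2 ^ m) := by
    intro f t
    rw [tsum_eq_single ⌊2 ^ m * t⌋₊]
    · simp [S, dyadicFloor]
    · intro j hj
      rw [Set.indicator_of_notMem (s := S j) (fun h => hj (Eq.symm h)), zero_mul]
  rw [lintegral_congr fun ω => hsum (fun a => expNeg (potential b s₁ s₂ κ T U a ω)) (M ω),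
    lintegral_congr fun t => hsum (fun a => nearestDensity b s₁ s₂ κ c₁ c₂ a t) t,
    lintegral_tsum, lintegral_tsum]
  · exact tsum_congr fun j =>
      lintegral_indicator_potential hb hs₁ hc₁ hT hU hTU hMm hM (by positivity) (hS j)
  · intro j
    exact ((measurable_one.indicator (hS j)).aemeasurable).mul
      (measurable_nearestDensity hb hs₁ (by positivity))
  · intro j
    exact (((measurable_one.indicator (hS j)).comp hMm).mul (measurable_expNeg.comp
      (measurable_potential hT.measurable_point hU.measurable_point measurable_const))).aemeasurable

lemma tendsto_potential_dyadicFloor {Ω : Type*} {T U : ℕ → Ω → ℝ} (hb : 0 < b) (hs₁ : 0 ≤ s₁) (hs₂ : 0 ≤ s₂) (hκ : 0 ≤ κ)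
    {ω : Ω} (hT : ∀ n, 0 ≤ T n ω) (hU : ∀ n, 0 ≤ U n ω) {a : ℝ} (ha : 0 ≤ a) :
    Tendsto (fun m => potential b s₁ s₂ κ T U (dyadicFloor m a) ω) atTop
      (𝓝 (potential b s₁ s₂ κ T U a ω)) := by
  have hm := monotone_dyadicFloor ha
  have hl := tendsto_dyadicFloor ha
  have ht : ∀ (s : ℝ), 0 ≤ s → ∀ t, 0 ≤ t →
      Tendsto (fun m => att b s (dyadicFloor m a) t) atTop (𝓝 (att b s a t)) :=
    fun s hs t ht => (continuous_att hb hs ha ht).tendsto.comp hl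
  refine (tendsto_tsum_of_monotone (fun n i j hij => ?_) fun n => ht s₁ hs₁ _ (hT n)).add
    (tendsto_tsum_of_monotone (fun n i j hij => add_le_add (cut_mono ?_ _) ?_) fun n =>
      (tendsto_cut (fun m => ?_) ?_ _).add (ht s₂ hs₂ _ (hU n)))
  · exact att_mono hb hs₁ (dyadicFloor_nonneg i a) (hm hij) (hT n)
  · exact mul_le_mul_of_nonneg_left (hm hij) hκ
  · exact att_mono hb hs₂ (dyadicFloor_nonneg i a) (hm hij) (hU n)
  · exact mul_le_mul_of_nonneg_left (dyadicFloor_le m ha) hκ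
  · exact hl.const_mul κ

lemma tendsto_nearestDensity_dyadicFloor (hb : 0 < b) (hs₁ : 0 ≤ s₁) (hs₂ : 0 ≤ s₂)
    (hκ : 0 ≤ κ) {t : ℝ} (ht : 0 ≤ t) :
    Tendsto (fun m => nearestDensity b s₁ s₂ κ c₁ c₂ (dyadicFloor m t) t) atTop
      (𝓝 (nearestDensity b s₁ s₂ κ c₁ c₂ t t)) := by
  have hm := monotone_dyadicFloor ht
  have hl := tendsto_dyadicFloor ht
  have h0 := fun m => dyadicFloor_nonneg m t
  have e : ∀ {f : ℕ → ℝ≥0∞} {x : ℝ≥0∞}, Tendsto f atTop (𝓝 x) →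
      Tendsto (fun m => expNeg (f m)) atTop (𝓝 (expNeg x)) :=
    fun h => (continuous_expNeg.tendsto _).comp h
  have h1 := e ((continuous_att hb hs₁ ht ht).tendsto.comp hl)
  have h2 := e (ENNReal.Tendsto.const_mul (a := ENNReal.ofReal c₁)
    (tendsto_elossMass hb hs₁ h0 hm hl (monotone_const (c := t)) tendsto_const_nhds)
    (Or.inr ENNReal.ofReal_ne_top))
  have h3 := e (ENNReal.Tendsto.const_mul (a := ENNReal.ofReal c₂)
    (tendsto_elossMass hb hs₂ h0 hm hl (hm.const_mul hκ) (hl.const_mul κ))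
    (Or.inr ENNReal.ofReal_ne_top))
  refine ENNReal.Tendsto.mul (ENNReal.Tendsto.mul (ENNReal.Tendsto.mul tendsto_const_nhds
    (Or.inr ?_) h1 (Or.inr ?_)) (Or.inr ?_) h2 (Or.inr ?_)) (Or.inr ?_) h3 (Or.inr ?_)
  all_goals first
    | exact expNeg_ne_top _
    | exact ENNReal.ofReal_ne_top
    | exact ENNReal.mul_ne_top ENNReal.ofReal_ne_top (expNeg_ne_top _)
    | exact ENNReal.mul_ne_top (ENNReal.mul_ne_top ENNReal.ofReal_ne_top (expNeg_ne_top _))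
        (expNeg_ne_top _)

/-- The dyadic identity passes to the limit by dominated convergence: the left integrand is at most
1, the right one at most `c₁ exp (-c₁ t)` because the mean loss is at least `t`. -/
lemma lintegral_potential_nearest [IsProbabilityMeasure P] (hb : 1 < b) (hs₁ : 0 ≤ s₁)
    (hs₂ : 0 ≤ s₂) (hκ : 0 ≤ κ) (hc₁ : 0 < c₁) (hT : IsHalfLinePPP P c₁ T)
    (hU : IsHalfLinePPP P c₂ U) (hTU : IndepFun (fun ω n => T n ω) (fun ω n => U n ω) P)
    (hMm : Measurable M) (hM : ∀ᵐ ω ∂P, IsLeast (Set.range fun n => T n ω) (M ω)) :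
    ∫⁻ ω, expNeg (potential b s₁ s₂ κ T U (M ω) ω) ∂P
      = ∫⁻ t in Set.Ioi 0, nearestDensity b s₁ s₂ κ c₁ c₂ t t := by
  have hb0 : 0 < b := zero_lt_one.trans hb
  have hM0 : ∀ᵐ ω ∂P, 0 ≤ M ω := by
    filter_upwards [hM] with ω hω
    obtain ⟨n, hn⟩ := hω.1
    rw [← hn]; exact hT.nonneg n ω
  have t1 := tendsto_lintegral_expNeg P
    (f := fun m ω => potential b s₁ s₂ κ T U (dyadicFloor m (M ω)) ω)
    (g := fun ω => potential b s₁ s₂ κ T U (M ω) ω)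
    (fun m => measurable_potential hT.measurable_point hU.measurable_point
      (by unfold dyadicFloor; fun_prop))
    (by
      filter_upwards [hM0] with ω hω
      exact tendsto_potential_dyadicFloor hb0 hs₁ hs₂ hκ (fun n => hT.nonneg n ω)
        (fun n => hU.nonneg n ω) hω)
  have t2 : Tendsto (fun m => ∫⁻ t in Set.Ioi 0,
      nearestDensity b s₁ s₂ κ c₁ c₂ (dyadicFloor m t) t) atTop
      (𝓝 (∫⁻ t in Set.Ioi 0, nearestDensity b s₁ s₂ κ c₁ c₂ t t)) := by
    refine tendsto_lintegral_of_dominated_convergence'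
      (fun t => ENNReal.ofReal c₁ * ENNReal.ofReal (Real.exp (-(c₁ * t)))) (fun m => ?_)
      (fun m => ?_) ?_ ?_
    · have hfl : Measurable fun t : ℝ => ⌊2 ^ m * t⌋₊ := by fun_prop
      have : AEMeasurable (fun t => ∑' j : ℕ, {t : ℝ | ⌊2 ^ m * t⌋₊ = j}.indicator 1 t *
          nearestDensity b s₁ s₂ κ c₁ c₂ ((j : ℝ) / 2 ^ m) t) (volume.restrict (Set.Ioi 0)) := by
        refine AEMeasurable.tsum fun j => ?_
        exact ((measurable_one.indicator (hfl (measurableSet_singleton j))).aemeasurable).mul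
          (measurable_nearestDensity hb hs₁ (by positivity))
      refine this.congr ?_
      filter_upwards with t
      rw [tsum_eq_single ⌊2 ^ m * t⌋₊]
      · simp [dyadicFloor]
      · intro j hj
        rw [Set.indicator_of_notMem (s := {t : ℝ | ⌊2 ^ m * t⌋₊ = j})
          (fun h => hj (Eq.symm h)), zero_mul]
    · filter_upwards [self_mem_ae_restrict measurableSet_Ioi] with t ht
      have ht0 : 0 ≤ t := le_of_lt ht
      unfold nearestDensity
      refine (mul_le_of_le_one_right' (expNeg_le_one _)).trans ?_
      refine mul_le_mul' (mul_le_of_le_one_right' (expNeg_le_one _)) ?_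
      rw [← expNeg_ofReal (by positivity), ENNReal.ofReal_mul hc₁.le]
      refine expNeg_antitone (mul_le_mul_right ?_ _)
      exact ofReal_le_elossMass hb hs₁ (dyadicFloor_nonneg m t) ht0
    · rw [lintegral_const_mul _ (by fun_prop), lintegral_exp_neg_mul_Ioi hc₁]
      exact ENNReal.mul_ne_top ENNReal.ofReal_ne_top ENNReal.ofReal_ne_top
    · filter_upwards [self_mem_ae_restrict measurableSet_Ioi] with t ht
      exact tendsto_nearestDensity_dyadicFloor hb0 hs₁ hs₂ hκ (le_of_lt ht)
  refine tendsto_nhds_unique t1 (t2.congr fun m => ?_)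
  exact (lintegral_potential_dyadicFloor hb hs₁ hc₁ hT hU hTU hMm hM m).symm

lemma rho_nonneg {δ α : ℝ} (hδ : 0 ≤ δ) : 0 ≤ rho δ α := by
  refine setIntegral_nonneg measurableSet_Ioi fun u hu => ?_
  have hu0 : 0 < u := (Real.rpow_nonneg hδ _).trans_lt hu
  positivity

/-- The mean of the interference factors on the event that no station of the second tier has
squared distance below `κ` times that of the closest station of the first tier. -/
theorem lintegral_potential_nearest_eq [IsProbabilityMeasure P] (hb : 1 < b) (hs₁ : 0 ≤ s₁)
    (hs₂ : 0 ≤ s₂) (hκ : 0 < κ) (hc₁ : 0 < c₁) (hc₂ : 0 < c₂) (hT : IsHalfLinePPP P c₁ T)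
    (hU : IsHalfLinePPP P c₂ U) (hTU : IndepFun (fun ω n => T n ω) (fun ω n => U n ω) P)
    (hMm : Measurable M) (hM : ∀ᵐ ω ∂P, IsLeast (Set.range fun n => T n ω) (M ω)) :
    ENNReal.ofReal (1 + s₁) * ∫⁻ ω, expNeg (potential b s₁ s₂ κ T U (M ω) ω) ∂P
      = ENNReal.ofReal (c₁ / (c₁ * (1 + rho s₁ (2 * b))
          + κ * c₂ * (1 + rho (s₂ / κ ^ b) (2 * b)))) := by
  rw [lintegral_potential_nearest hb hs₁ hs₂ hκ.le hc₁ hT hU hTU hMm hM,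
    ← lintegral_const_mul' _ _ ENNReal.ofReal_ne_top]
  set D := c₁ * (1 + rho s₁ (2 * b)) + κ * c₂ * (1 + rho (s₂ / κ ^ b) (2 * b)) with hD
  have r1 : 0 ≤ rho s₁ (2 * b) := rho_nonneg hs₁
  have r2 : 0 ≤ rho (s₂ / κ ^ b) (2 * b) := rho_nonneg (by positivity)
  have hDpos : 0 < D := by positivity
  -- The potential also counts the serving station, whose factor at `t = a` is `1 / (1 + s₁)`; the
  -- prefactor cancels it. By scaling, the remaining exponent is linear in `t`.
  have h1 : ∀ t ∈ Set.Ioi (0 : ℝ), ENNReal.ofReal (1 + s₁) * nearestDensity b s₁ s₂ κ c₁ c₂ t t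
      = ENNReal.ofReal c₁ * ENNReal.ofReal (Real.exp (-(D * t))) := by
    intro t ht
    have ht0 : 0 < t := ht
    have m1 := lossMass_mul_self hb hs₁ ht0 one_pos
    rw [one_mul, Real.one_rpow, div_one] at m1
    have m2 := lossMass_mul_self hb hs₂ ht0 hκ
    rw [nearestDensity, elossMass, elossMass,
      lintegral_one_sub_expNeg_cut_add_att hb hs₁ ht0.le ht0.le,
      lintegral_one_sub_expNeg_cut_add_att hb hs₂ ht0.le (by positivity), m1, m2,
      expNeg_att hs₁ ht0.le ht0.le, div_self ht0.ne', Real.one_rpow, mul_one,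
      ← ENNReal.ofReal_mul hc₁.le, ← ENNReal.ofReal_mul hc₁.le, ← ENNReal.ofReal_mul hc₂.le,
      expNeg_ofReal (by positivity),
      expNeg_ofReal (by positivity),
      ← ENNReal.ofReal_mul (by positivity), ← ENNReal.ofReal_mul (by positivity),
      ← ENNReal.ofReal_mul (by positivity), ← ENNReal.ofReal_mul hc₁.le, mul_assoc (c₁ * _),
      ← Real.exp_add]
    congr 1
    have e : -(c₁ * (t * (1 + rho s₁ (2 * b)))) + -(c₂ * (κ * t * (1 + rho (s₂ / κ ^ b) (2 * b))))
        = -(D * t) := by rw [hD]; ring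
    rw [e]
    field_simp
  rw [setLIntegral_congr_fun measurableSet_Ioi h1, lintegral_const_mul _ (by fun_prop),
    lintegral_exp_neg_mul_Ioi hDpos, ← ENNReal.ofReal_mul hc₁.le]
  congr 1
  simp [div_eq_mul_inv]

end Nearest

/-! ### Averaging over the fading with fixed locations -/

section Fading

variable {Ω : Type*} [MeasurableSpace Ω] {P : Measure Ω} {E : ℕ → Ω → ℂ}

/-- As the term `i₀` vanishes, the sum is measurable with respect to the other coefficients alone.
-/
lemma indepFun_tsum_fading (hm : ∀ i, Measurable (E i)) (hi : iIndepFun E P) {f : ℕ → ℂ → ℝ≥0∞}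
    (hf : ∀ i, Measurable (f i)) {i₀ : ℕ} (h₀ : f i₀ = 0) :
    IndepFun (fun ω => ∑' i, f i (E i ω)) (E i₀) P := by
  have h := indep_iSup_of_disjoint (fun i => (hm i).comap_le) hi
    (S := {i₀}ᶜ) (T := {i₀}) disjoint_compl_left
  refine (IndepFun_iff_Indep _ _ _).2 (indep_of_indep_of_le_left (indep_of_indep_of_le_right h ?_) ?_)
  · simp
  · refine Measurable.comap_le ?_
    refine @Measurable.tsum Ω ℝ≥0∞ ℕ (⨆ i ∈ ({i₀}ᶜ : Set ℕ), MeasurableSpace.comap (E i) inferInstance)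
      _ _ _ _ _ _ _ _ (SummationFilter.unconditional ℕ) _ _ _ fun i => ?_
    by_cases hi₀ : i = i₀
    · subst hi₀
      simp only [h₀, Pi.zero_apply]
      exact measurable_const
    · have hE : Measurable[MeasurableSpace.comap (E i) inferInstance] (E i) := comap_measurable _
      exact (hf i).comp (hE.mono (le_iSup₂_of_le i hi₀ le_rfl) le_rfl)

variable [IsProbabilityMeasure P]

lemma lintegral_expNeg_fading (hm : ∀ i, Measurable (E i)) (hl : ∀ i, P.map (E i) = complexNormal)
    (hi : iIndepFun E P) {c : ℕ → ℝ} (hc : ∀ i, 0 ≤ c i) :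
    ∫⁻ ω, expNeg (∑' i, ENNReal.ofReal (c i * ‖E i ω‖ ^ 2)) ∂P
      = expNeg (∑' i, ENNReal.ofReal (Real.log (1 + c i))) := by
  have t1 := tendsto_lintegral_expNeg P
    (f := fun n ω => ∑ i ∈ Finset.range n, ENNReal.ofReal (c i * ‖E i ω‖ ^ 2))
    (g := fun ω => ∑' i, ENNReal.ofReal (c i * ‖E i ω‖ ^ 2))
    (fun n => by fun_prop) (by filter_upwards with ω using ENNReal.tendsto_nat_tsum _)
  have t2 := (continuous_expNeg.tendsto _).comp
    (ENNReal.tendsto_nat_tsum fun i => ENNReal.ofReal (Real.log (1 + c i)))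
  refine tendsto_nhds_unique t1 (t2.congr fun n => ?_)
  simp only [Function.comp_apply, expNeg_sum]
  rw [lintegral_prod_eq_prod_lintegral_of_indepFun _
    (fun i ω => expNeg (ENNReal.ofReal (c i * ‖E i ω‖ ^ 2)))
    (hi.comp (fun i z => expNeg (ENNReal.ofReal (c i * ‖z‖ ^ 2))) fun i => by fun_prop)
    (fun i => by fun_prop)]
  refine Finset.prod_congr rfl fun i _ => ?_
  rw [← complexNormal_expNeg (hc i), ← hl i, lintegral_map (by fun_prop) (hm i)]

/-- The probability that an exponential signal exceeds an independent interference. -/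
lemma prob_fading (hm : ∀ i, Measurable (E i)) (hl : ∀ i, P.map (E i) = complexNormal)
    (hi : iIndepFun E P) {c : ℕ → ℝ} (hc : ∀ i, 0 ≤ c i) {i₀ : ℕ} (h₀ : c i₀ = 0) :
    P {ω | ∑' i, ENNReal.ofReal (c i * ‖E i ω‖ ^ 2) < ENNReal.ofReal (‖E i₀ ω‖ ^ 2)}
      = expNeg (∑' i, ENNReal.ofReal (Real.log (1 + c i))) := by
  set I : Ω → ℝ≥0∞ := fun ω => ∑' i, ENNReal.ofReal (c i * ‖E i ω‖ ^ 2) with hI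
  have hIm : Measurable I := Measurable.tsum fun i => by fun_prop
  have hind : IndepFun I (E i₀) P := indepFun_tsum_fading hm hi
    (f := fun i z => ENNReal.ofReal (c i * ‖z‖ ^ 2)) (fun i => by fun_prop)
    (by ext; simp [h₀])
  have hmap := (indepFun_iff_map_prod_eq_prod_map_map hIm.aemeasurable (hm i₀).aemeasurable).1 hind
  have hS : MeasurableSet {p : ℝ≥0∞ × ℂ | p.1 < ENNReal.ofReal (‖p.2‖ ^ 2)} :=
    measurableSet_lt (by fun_prop) (by fun_prop)
  have h1 : P {ω | I ω < ENNReal.ofReal (‖E i₀ ω‖ ^ 2)}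
      = P.map (fun ω => (I ω, E i₀ ω)) {p : ℝ≥0∞ × ℂ | p.1 < ENNReal.ofReal (‖p.2‖ ^ 2)} := by
    rw [Measure.map_apply (hIm.prodMk (hm i₀)) hS]; rfl
  have : IsProbabilityMeasure (P.map (E i₀)) := Measure.isProbabilityMeasure_map (hm i₀).aemeasurable
  rw [h1, hmap, Measure.prod_apply hS, lintegral_map (measurable_measure_prodMk_left hS) hIm,
    ← lintegral_expNeg_fading hm hl hi hc]
  refine lintegral_congr fun ω => ?_
  rw [hl i₀]
  exact complexNormal_norm_sq_gt (I ω)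

end Fading

/-! ### Positivity of `ζ` and measurability of the nearest station -/

/-- With `b = N / (N - 1) > 1`, the claim `L β(L, b) < 1` reads `Γ(L + 1) Γ(b) < Γ(L + b)`. It
follows by induction on `L` from the recurrence of `Γ`, starting with `Γ(b) < b Γ(b)`. -/
lemma zeta_pos (B : ℕ) {N : ℕ} (hN : 2 ≤ N) : 0 < zeta B N := by
  have hN' : (2 : ℝ) ≤ N := by exact_mod_cast hN
  set b : ℝ := (N : ℝ) / ((N : ℝ) - 1) with hb
  have hb1 : 1 < b := by rw [hb, one_lt_div (by linarith)]; linarith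
  have key : ∀ n : ℕ, Real.Gamma ((n : ℝ) + 1 + 1) * Real.Gamma b < Real.Gamma ((n : ℝ) + 1 + b) := by
    intro n
    induction n with
    | zero =>
      have h1 : Real.Gamma (((0 : ℕ) : ℝ) + 1 + 1) = 1 := by
        norm_num [Real.Gamma_two]
      rw [h1, Nat.cast_zero, zero_add, add_comm (1 : ℝ) b, Real.Gamma_add_one (by linarith)]
      have := Real.Gamma_pos_of_pos (show 0 < b by linarith)
      nlinarith
    | succ n ih =>
      have h1 : (((n + 1 : ℕ) : ℝ) + 1 + 1) = ((n : ℝ) + 1 + 1) + 1 := by push_cast; ring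
      have h2 : (((n + 1 : ℕ) : ℝ) + 1 + b) = ((n : ℝ) + 1 + b) + 1 := by push_cast; ring
      have hn : (0 : ℝ) ≤ n := n.cast_nonneg
      rw [h1, h2, Real.Gamma_add_one (s := (n : ℝ) + 1 + 1) (by linarith),
        Real.Gamma_add_one (s := (n : ℝ) + 1 + b) (by linarith), mul_assoc]
      have hp := Real.Gamma_pos_of_pos (show 0 < (n : ℝ) + 1 + b by linarith)
      calc ((n : ℝ) + 1 + 1) * (Real.Gamma ((n : ℝ) + 1 + 1) * Real.Gamma b)
          < ((n : ℝ) + 1 + 1) * Real.Gamma ((n : ℝ) + 1 + b) := by gcongr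
        _ ≤ ((n : ℝ) + 1 + b) * Real.Gamma ((n : ℝ) + 1 + b) := by gcongr
  obtain ⟨n, hn⟩ : ∃ n : ℕ, 2 ^ B = n + 1 := ⟨2 ^ B - 1, by have := Nat.one_le_two_pow (n := B); omega⟩
  have hL : (2 : ℝ) ^ B = (n : ℝ) + 1 := by exact_mod_cast hn
  have hn0 : (0 : ℝ) ≤ n := n.cast_nonneg
  rw [zeta, hL, ProbabilityTheory.beta, ← mul_div_assoc, ← mul_assoc,
    ← Real.Gamma_add_one (by linarith), sub_pos, div_lt_one (Real.Gamma_pos_of_pos (by linarith))]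
  exact key n

lemma measurable_nearest : Measurable nearest := by
  refine measurable_to_countable' fun n => ?_
  let A : ℕ → Set (ℕ → Plane) := fun n => {x | ∀ m, ‖x n‖ ≤ ‖x m‖}
  have hA : ∀ n, MeasurableSet (A n) := fun n => by
    simp only [A, Set.ofPred_forall]
    exact MeasurableSet.iInter fun m => measurableSet_le (by fun_prop) (by fun_prop)
  -- The second set collects the sequences without a closest point, for which `sInf ∅ = 0`.
  have h : nearest ⁻¹' {n} = (A n ∩ ⋂ m ∈ Set.Iio n, (A m)ᶜ)
      ∪ {x | n = 0 ∧ x ∈ ⋂ m, (A m)ᶜ} := by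
    ext x
    simp only [Set.mem_preimage, Set.mem_singleton_iff, Set.mem_union, Set.mem_inter_iff,
      Set.mem_iInter, Set.mem_compl_iff, Set.mem_Iio]
    constructor
    · rintro rfl
      by_cases hx : ({n | ∀ m, ‖x n‖ ≤ ‖x m‖} : Set ℕ).Nonempty
      · exact Or.inl ⟨Nat.sInf_mem hx, fun m hm => Nat.notMem_of_lt_sInf hm⟩
      · refine Or.inr ⟨?_, fun m hm => hx ⟨m, hm⟩⟩
        rw [nearest, Set.not_nonempty_iff_eq_empty.1 hx, Nat.sInf_empty]
    · rintro (⟨h1, h2⟩ | ⟨rfl, h2⟩)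
      · refine le_antisymm (Nat.sInf_le h1) ?_
        by_contra hlt
        have hmem : nearest x ∈ {n | ∀ m, ‖x n‖ ≤ ‖x m‖} := Nat.sInf_mem ⟨n, h1⟩
        exact h2 _ (not_le.1 hlt) hmem
      · have : ({n | ∀ m, ‖x n‖ ≤ ‖x m‖} : Set ℕ) = ∅ :=
          Set.eq_empty_of_forall_notMem fun m hm => h2 m hm
        rw [nearest, this, Nat.sInf_empty]
  rw [h]
  refine ((hA n).inter (MeasurableSet.biInter (Set.to_countable _) fun m _ => (hA m).compl)).union ?_
  by_cases hn : n = 0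
  · simp only [hn, true_and]
    exact MeasurableSet.iInter fun m => (hA m).compl
  · simp [hn]

lemma measurable_eval_index {E : Type*} [MeasurableSpace E] :
    Measurable fun p : ℕ × (ℕ → E) => p.2 p.1 :=
  measurable_from_prod_countable_right fun n => measurable_pi_apply n

lemma measurable_eval_nearest : Measurable fun x : ℕ → Plane => x (nearest x) :=
  measurable_eval_index.comp (measurable_nearest.prodMk measurable_id)

@[fun_prop] lemma measurable_nearestDist : Measurable nearestDist :=
  measurable_eval_nearest.norm

/-! ### Almost sure properties of the planar process -/

section Plane

variable {Ω : Type*} [MeasurableSpace Ω] {P : Measure Ω} {lam : ℝ}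
  {X : ℕ → Ω → Plane}

lemma IsHomogeneousPPP.ae_pointCount_ne_top (hX : IsHomogeneousPPP P lam X) {B : Set Plane}
    (hB : MeasurableSet B) (hB' : volume B < ∞) : ∀ᵐ ω ∂P, pointCount X B ω ≠ ∞ := by
  rw [ae_iff]
  have h := congrArg (fun μ => μ {∞}) (hX.count_law B hB hB')
  rw [Measure.map_apply (hX.measurable_pointCount hB) (measurableSet_singleton _),
    Measure.map_apply (by fun_prop) (measurableSet_singleton _)] at h
  have h0 : ((fun j : ℕ => (j : ℝ≥0∞)) ⁻¹' {∞}) = ∅ := by ext; simp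
  rw [h0, measure_empty] at h
  simp only [ne_eq, not_not]
  exact h

/-- Almost surely every ball contains finitely many points, so a closest one exists in a ball
containing `X 0`. Without this, `nearest` would be a default value. -/
lemma IsHomogeneousPPP.ae_nearest (hX : IsHomogeneousPPP P lam X) :
    ∀ᵐ ω ∂P, ∀ m, nearestDist (fun n => X n ω) ≤ ‖X m ω‖ := by
  have h := ae_all_iff.2 fun r : ℕ => hX.ae_pointCount_ne_top (B := Metric.closedBall 0 r)
    measurableSet_closedBall measure_closedBall_lt_top
  filter_upwards [h] with ω hω
  obtain ⟨r, hr⟩ := exists_nat_ge ‖X 0 ω‖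
  have hfin : {n | X n ω ∈ Metric.closedBall 0 (r : ℝ)}.Finite := by
    refine (ENNReal.finite_const_le_of_tsum_ne_top (hω r) one_ne_zero).subset fun n hn => ?_
    simp only [Set.mem_ofPred_eq] at hn ⊢
    rw [Set.indicator_of_mem hn]
  obtain ⟨n, hn, hmin⟩ := hfin.exists_minimalFor (fun n => ‖X n ω‖) _ ⟨0, by simpa using hr⟩
  have hne : ({n | ∀ m, ‖X n ω‖ ≤ ‖X m ω‖} : Set ℕ).Nonempty := by
    refine ⟨n, fun m => ?_⟩
    by_cases hm : X m ω ∈ Metric.closedBall 0 (r : ℝ)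
    · rcases le_total ‖X n ω‖ ‖X m ω‖ with h' | h'
      · exact h'
      · exact hmin hm h'
    · have h1 : ‖X n ω‖ ≤ r := by simpa using hn
      have h2 : (r : ℝ) < ‖X m ω‖ := by simpa using hm
      exact h1.trans h2.le
  exact Nat.sInf_mem hne

lemma IsHomogeneousPPP.ae_isLeast (hX : IsHomogeneousPPP P lam X) :
    ∀ᵐ ω ∂P, IsLeast (Set.range fun n => ‖X n ω‖ ^ 2) (nearestDist (fun n => X n ω) ^ 2) := by
  filter_upwards [hX.ae_nearest] with ω hω
  refine ⟨⟨nearest fun n => X n ω, rfl⟩, ?_⟩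
  rintro _ ⟨n, rfl⟩
  exact pow_le_pow_left₀ (norm_nonneg _) (hω n) 2

variable [IsProbabilityMeasure P]

/-- The weight `c = ∞` on `{0}` gives void probability `exp (-0) = 1`, as a point has area 0. -/
lemma IsHomogeneousPPP.ae_ne_zero (hX : IsHomogeneousPPP P lam X) (hlam : 0 ≤ lam) :
    ∀ᵐ ω ∂P, ∀ n, X n ω ≠ 0 := by
  have h := hX.lintegral_expNeg_pointCount hlam (measurableSet_singleton 0) (by simp) ∞
  rw [measure_singleton, zero_mul, mul_zero, expNeg_zero] at h
  have hm := hX.measurable_pointCount (measurableSet_singleton (0 : Plane))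
  have h2 := ae_eq_of_ae_le_of_lintegral_le (μ := P)
    (f := fun ω => expNeg (pointCount X {0} ω * ∞)) (g := fun _ => 1)
    (by filter_upwards with ω using expNeg_le_one _) (by rw [h]; simp) (by fun_prop)
    (by rw [h]; simp)
  filter_upwards [h2] with ω hω n hn
  have h3 : pointCount X {0} ω ≠ 0 := by
    intro h0
    have := ENNReal.tsum_eq_zero.1 h0 n
    rw [Set.indicator_of_mem (by simpa using hn)] at this
    exact one_ne_zero this
  rw [ENNReal.mul_top h3, expNeg_top] at hω
  exact zero_ne_one hω

lemma IsHomogeneousPPP.isHalfLinePPP (hX : IsHomogeneousPPP P lam X) (hlam : 0 ≤ lam) :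
    IsHalfLinePPP P (lam * Real.pi) fun n ω => ‖X n ω‖ ^ 2 where
  measurable_point n := by have := hX.measurable_point n; fun_prop
  nonneg n ω := by positivity
  laplace v hv := by
    rw [hX.laplace hlam (v := fun x => v (‖x‖ ^ 2)) (by fun_prop),
      lintegral_norm_sq_plane (f := fun t => 1 - expNeg (v t)) (by fun_prop), ← mul_assoc,
      ENNReal.ofReal_mul hlam, ← NNReal.coe_real_pi, ENNReal.ofReal_coe_nnreal]

end Plane

/-! ### Averaging over the locations of both tiers -/

/-- The coefficient of the fading power `‖g i‖ ^ 2` of station `i` in the interference relative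
to the mean signal power; the stations of the serving tier come first. -/
noncomputable def relCoeff (α s₁ s₂ : ℝ) (x y : ℕ → Plane) : ℕ ⊕ ℕ → ℝ
  | Sum.inl n => if n = nearest x then 0 else s₁ * (nearestDist x ^ 2 / ‖x n‖ ^ 2) ^ (α / 2)
  | Sum.inr m => s₂ * (nearestDist x ^ 2 / ‖y m‖ ^ 2) ^ (α / 2)

lemma relCoeff_nonneg {α s₁ s₂ : ℝ} (hs₁ : 0 ≤ s₁) (hs₂ : 0 ≤ s₂) (x y : ℕ → Plane) (i : ℕ ⊕ ℕ) :
    0 ≤ relCoeff α s₁ s₂ x y i := by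
  rcases i with n | m
  · simp only [relCoeff]
    split_ifs
    · exact le_rfl
    · positivity
  · simp only [relCoeff]; positivity

lemma measurable_relCoeff (α s₁ s₂ : ℝ) (i : ℕ ⊕ ℕ) :
    Measurable fun p : (ℕ → Plane) × (ℕ → Plane) => relCoeff α s₁ s₂ p.1 p.2 i := by
  rcases i with n | m
  · simp only [relCoeff]
    refine Measurable.ite ?_ measurable_const (by fun_prop)
    exact (measurable_nearest.comp measurable_fst) (measurableSet_singleton n) |>.congr
      (by ext; simp [eq_comm])
  · simp only [relCoeff]; fun_prop

section TwoTier

variable {Ω : Type*} [MeasurableSpace Ω] {P : Measure Ω} [IsProbabilityMeasure P]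
  {lam₁ lam₂ α s₁ s₂ k : ℝ} {X Y : ℕ → Ω → Plane}

/-- The half-line result for squared distances, with `b = α / 2`, `κ = k ^ 2` and densities `λπ`.
The association event is the `cut` part of the potential, and the factor `1 + s₁` removes the
serving station from the sum. -/
lemma lintegral_assoc_mul_expNeg (hα : 2 < α) (hs₁ : 0 ≤ s₁) (hs₂ : 0 ≤ s₂) (hk : 0 < k)
    (h₁ : 0 < lam₁) (h₂ : 0 < lam₂) (hX : IsHomogeneousPPP P lam₁ X)
    (hY : IsHomogeneousPPP P lam₂ Y) (hXY : IndepFun (fun ω n => X n ω) (fun ω n => Y n ω) P) :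
    ∫⁻ ω, {ω | k * nearestDist (fun n => X n ω) ≤ nearestDist (fun n => Y n ω)}.indicator 1 ω *
        expNeg (∑' i, ENNReal.ofReal
          (Real.log (1 + relCoeff α s₁ s₂ (fun n => X n ω) (fun n => Y n ω) i))) ∂P
      = ENNReal.ofReal (lam₁ / (lam₁ * (1 + rho s₁ α)
          + k ^ 2 * lam₂ * (1 + rho (s₂ / k ^ α) α))) := by
  have hXm : Measurable fun ω n => X n ω := measurable_pi_lambda _ hX.measurable_point
  have hMm : Measurable fun ω => nearestDist (fun n => X n ω) ^ 2 :=
    (measurable_nearestDist.comp hXm).pow_const 2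
  have key := lintegral_potential_nearest_eq (b := α / 2) (κ := k ^ 2) (by linarith) hs₁ hs₂
    (by positivity) (mul_pos h₁ Real.pi_pos) (mul_pos h₂ Real.pi_pos) (hX.isHalfLinePPP h₁.le)
    (hY.isHalfLinePPP h₂.le)
    (hXY.comp (φ := fun x n => ‖x n‖ ^ 2) (ψ := fun x n => ‖x n‖ ^ 2) (by fun_prop) (by fun_prop))
    hMm hX.ae_isLeast
  have e1 : 2 * (α / 2) = α := by ring
  have e2 : (k ^ 2) ^ (α / 2) = k ^ α := by
    rw [← Real.rpow_natCast k 2, ← Real.rpow_mul hk.le, Nat.cast_ofNat, e1]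
  have e3 : lam₁ * Real.pi / (lam₁ * Real.pi * (1 + rho s₁ α)
      + k ^ 2 * (lam₂ * Real.pi) * (1 + rho (s₂ / k ^ α) α))
      = lam₁ / (lam₁ * (1 + rho s₁ α) + k ^ 2 * lam₂ * (1 + rho (s₂ / k ^ α) α)) := by
    rw [← mul_div_mul_right lam₁ _ Real.pi_ne_zero]
    congr 1; ring
  rw [e1, e2, e3] at key
  rw [← key, ← lintegral_const_mul' _ _ ENNReal.ofReal_ne_top]
  refine lintegral_congr_ae ?_
  filter_upwards [hX.ae_isLeast, hY.ae_isLeast, hX.ae_ne_zero h₁.le] with ω hXω hYω hX0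
  set x := fun n => X n ω
  set y := fun n => Y n ω
  have hM : 0 < nearestDist x := norm_pos_iff.2 (hX0 (nearest x))
  rw [potential, ENNReal.tsum_eq_add_tsum_ite (nearest x), ENNReal.tsum_add, expNeg_add, expNeg_add,
    expNeg_add, expNeg_tsum_cut hYω, Summable.tsum_sum ENNReal.summable ENNReal.summable,
    expNeg_add]
  have a1 : att (α / 2) s₁ (nearestDist x ^ 2) (‖X (nearest x) ω‖ ^ 2)
      = ENNReal.ofReal (Real.log (1 + s₁)) := by
    have : ‖X (nearest x) ω‖ = nearestDist x := rfl
    rw [att, this, div_self (by positivity), Real.one_rpow, mul_one]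
  have a2 : ENNReal.ofReal (1 + s₁) * expNeg (ENNReal.ofReal (Real.log (1 + s₁))) = 1 := by
    rw [expNeg_ofReal (Real.log_nonneg (by linarith)), Real.exp_neg, Real.exp_log (by linarith),
      ← ENNReal.ofReal_mul (by linarith), mul_inv_cancel₀ (by linarith), ENNReal.ofReal_one]
  have a3 : ∀ n, ENNReal.ofReal (Real.log (1 + relCoeff α s₁ s₂ x y (Sum.inl n)))
      = if n = nearest x then 0 else att (α / 2) s₁ (nearestDist x ^ 2) (‖X n ω‖ ^ 2) := by
    intro n
    simp only [relCoeff, att]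
    split_ifs <;> simp [x]
  have a4 : ∀ m, ENNReal.ofReal (Real.log (1 + relCoeff α s₁ s₂ x y (Sum.inr m)))
      = att (α / 2) s₂ (nearestDist x ^ 2) (‖Y m ω‖ ^ 2) := fun m => rfl
  have a5 : (Set.Ici (k ^ 2 * nearestDist x ^ 2)).indicator (1 : ℝ → ℝ≥0∞) (nearestDist y ^ 2)
      = {ω | k * nearestDist (fun n => X n ω) ≤ nearestDist (fun n => Y n ω)}.indicator 1 ω := by
    have : k ^ 2 * nearestDist x ^ 2 ≤ nearestDist y ^ 2 ↔ k * nearestDist x ≤ nearestDist y := by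
      rw [← mul_pow]
      exact pow_le_pow_iff_left₀ (by positivity) (norm_nonneg _) two_ne_zero
    simp only [Set.indicator_apply, Set.mem_Ici, this, Set.mem_ofPred_eq, Pi.one_apply]
    rfl
  simp_rw [a3, a4]
  rw [a5, a1]
  rw [← mul_assoc (ENNReal.ofReal (1 + s₁)),
    ← mul_assoc (ENNReal.ofReal (1 + s₁)), a2, one_mul, mul_left_comm]
  congr!

end TwoTier

/-! ### From the SIR event to relative interference -/

/-- The interference relative to the mean signal power. -/
noncomputable def relInterference (α s₁ s₂ : ℝ) (x y : ℕ → Plane) (g : ℕ ⊕ ℕ → ℂ) : ℝ≥0∞ :=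
  ∑' i, ENNReal.ofReal (relCoeff α s₁ s₂ x y i * ‖g i‖ ^ 2)

lemma measurable_totalPower (α p : ℝ) :
    Measurable fun q : (ℕ → Plane) × (ℕ → ℂ) => totalPower α p q.1 q.2 := by
  unfold totalPower rxPower
  exact Measurable.tsum fun n => by fun_prop

lemma totalPowerExceptNearest_eq (α p : ℝ) (x : ℕ → Plane) (g : ℕ → ℂ) :
    totalPowerExceptNearest α p x g
      = ∑' n, if n = nearest x then 0 else rxPower α p (x n) (g n) := by
  refine (tsum_subtype {n | n ≠ nearest x} fun n => rxPower α p (x n) (g n)).trans ?_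
  refine tsum_congr fun n => ?_
  by_cases h : n = nearest x <;> simp [h]

lemma measurable_totalPowerExceptNearest (α p : ℝ) :
    Measurable fun q : (ℕ → Plane) × (ℕ → ℂ) => totalPowerExceptNearest α p q.1 q.2 := by
  simp_rw [totalPowerExceptNearest_eq]
  refine Measurable.tsum fun n => Measurable.ite ?_ measurable_const ?_
  · exact (measurable_nearest.comp measurable_fst) (measurableSet_singleton n) |>.congr
      (by ext; simp [eq_comm])
  · unfold rxPower; fun_prop

lemma measurable_rxPower_nearest (α p : ℝ) :
    Measurable fun q : (ℕ → Plane) × (ℕ → ℂ) =>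
      rxPower α p (q.1 (nearest q.1)) (q.2 (nearest q.1)) := by
  have h1 : Measurable fun q : (ℕ → Plane) × (ℕ → ℂ) => q.1 (nearest q.1) :=
    measurable_eval_nearest.comp measurable_fst
  have h2 : Measurable fun q : (ℕ → Plane) × (ℕ → ℂ) => q.2 (nearest q.1) :=
    measurable_eval_index.comp ((measurable_nearest.comp measurable_fst).prodMk measurable_snd)
  unfold rxPower; fun_prop

lemma ofReal_mul_rxPower {c : ℝ} (hc : 0 ≤ c) (α p : ℝ) (z : Plane) (g : ℂ) :
    ENNReal.ofReal c * rxPower α p z g = rxPower α (c * p) z g := by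
  rw [rxPower, rxPower, ← ENNReal.ofReal_mul hc]
  congr 1; ring

lemma ofReal_mul_totalPowerExceptNearest {c : ℝ} (hc : 0 ≤ c) (α p : ℝ) (x : ℕ → Plane)
    (g : ℕ → ℂ) : ENNReal.ofReal c * totalPowerExceptNearest α p x g
      = totalPowerExceptNearest α (c * p) x g := by
  simp_rw [totalPowerExceptNearest, ← ENNReal.tsum_mul_left, ofReal_mul_rxPower hc]

lemma lt_sinr_iff {α δ S p₁ p₂ : ℝ} (hδ : 0 < δ) (hS : 0 < S) {x y : ℕ → Plane}
    (hx : 0 < nearestDist x) (g h : ℕ → ℂ) :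
    ENNReal.ofReal δ < rxPower α S (x (nearest x)) (g (nearest x)) /
        (totalPowerExceptNearest α p₁ x g + totalPower α p₂ y h)
      ↔ relInterference α (δ * p₁ / S) (δ * p₂ / S) x y (Sum.elim g h)
          < ENNReal.ofReal (‖g (nearest x)‖ ^ 2) := by
  set S' := S * nearestDist x ^ (-α) with hS'
  have hSpos : 0 < S' := mul_pos hS (Real.rpow_pos_of_pos hx _)
  have hratio : ∀ z : Plane, (nearestDist x ^ 2 / ‖z‖ ^ 2) ^ (α / 2)
      = nearestDist x ^ α * ‖z‖ ^ (-α) := by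
    intro z
    rw [← div_pow, ← Real.rpow_natCast, ← Real.rpow_mul (by positivity)]
    have : ((2 : ℕ) : ℝ) * (α / 2) = α := by push_cast; ring
    rw [this, Real.div_rpow hx.le (norm_nonneg _), Real.rpow_neg (norm_nonneg _), div_eq_mul_inv]
  have hxx : nearestDist x ^ (-α) * nearestDist x ^ α = 1 := by
    rw [← Real.rpow_add hx, neg_add_cancel, Real.rpow_zero]
  have hterm : ∀ p z c, ENNReal.ofReal (δ / S') * rxPower α p z c
      = ENNReal.ofReal (δ * p / S * (nearestDist x ^ 2 / ‖z‖ ^ 2) ^ (α / 2) * ‖c‖ ^ 2) := by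
    intro p z c
    rw [rxPower, ← ENNReal.ofReal_mul (by positivity), hratio]
    congr 1
    have hne : nearestDist x ^ (-α) ≠ 0 := (Real.rpow_pos_of_pos hx _).ne'
    have hinv : nearestDist x ^ α = (nearestDist x ^ (-α))⁻¹ := eq_inv_of_mul_eq_one_right hxx
    rw [hS', hinv]
    field_simp
  have hsum : ENNReal.ofReal (δ / S') *
        (totalPowerExceptNearest α p₁ x g + totalPower α p₂ y h)
      = relInterference α (δ * p₁ / S) (δ * p₂ / S) x y (Sum.elim g h) := by
    rw [mul_add, totalPowerExceptNearest_eq, totalPower, ← ENNReal.tsum_mul_left,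
      ← ENNReal.tsum_mul_left, relInterference,
      Summable.tsum_sum ENNReal.summable ENNReal.summable]
    congr 1
    · refine tsum_congr fun n => ?_
      by_cases hn : n = nearest x
      · simp [relCoeff, hn]
      · simp only [relCoeff, hn, if_false, Sum.elim_inl]
        exact hterm _ _ _
    · exact tsum_congr fun m => hterm _ _ _
  have hsig : rxPower α S (x (nearest x)) (g (nearest x))
      = ENNReal.ofReal S' * ENNReal.ofReal (‖g (nearest x)‖ ^ 2) := by
    rw [rxPower, ← ENNReal.ofReal_mul hSpos.le, hS']
    congr 1
    have : ‖x (nearest x)‖ = nearestDist x := rfl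
    rw [this]; ring
  -- As `δ` is finite and nonzero, the division can be cleared even when the interference is 0 or ∞.
  rw [ENNReal.lt_div_iff_mul_lt (Or.inr ENNReal.ofReal_ne_top) (Or.inr (by simpa using hδ)), hsig,
    ← hsum]
  have h1 : ENNReal.ofReal δ = ENNReal.ofReal S' * ENNReal.ofReal (δ / S') := by
    rw [← ENNReal.ofReal_mul hSpos.le, mul_div_cancel₀ _ hSpos.ne']
  rw [h1, mul_assoc, ENNReal.mul_lt_mul_iff_right (by simpa using hSpos) ENNReal.ofReal_ne_top]

/-! ### Joint probabilities by conditioning on the locations -/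

section Fubini

variable {Ω : Type*} [MeasurableSpace Ω] {P : Measure Ω} [IsProbabilityMeasure P]
  {lam₁ lam₂ α s₁ s₂ k : ℝ} {X Y : ℕ → Ω → Plane} {G : ℕ ⊕ ℕ → Ω → ℂ}

lemma prob_fading_sum (hm : ∀ i, Measurable (G i)) (hl : ∀ i, P.map (G i) = complexNormal)
    (hi : iIndepFun G P) {c : ℕ ⊕ ℕ → ℝ} (hc : ∀ i, 0 ≤ c i) {i₀ : ℕ ⊕ ℕ} (h₀ : c i₀ = 0) :
    P {ω | ∑' i, ENNReal.ofReal (c i * ‖G i ω‖ ^ 2) < ENNReal.ofReal (‖G i₀ ω‖ ^ 2)}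
      = expNeg (∑' i, ENNReal.ofReal (Real.log (1 + c i))) := by
  let e := Equiv.natSumNatEquivNat
  have h := prob_fading (E := fun j => G (e.symm j)) (P := P) (fun j => hm _) (fun j => hl _)
    (hi.precomp e.symm.injective) (c := fun j => c (e.symm j)) (fun j => hc _) (i₀ := e i₀)
    (by simpa using h₀)
  rw [e.symm.tsum_eq (fun i => ENNReal.ofReal (Real.log (1 + c i)))] at h
  rw [← h]
  congr 1
  ext ω
  simp only [Set.mem_ofPred_eq, Equiv.symm_apply_apply]
  rw [e.symm.tsum_eq (fun i => ENNReal.ofReal (c i * ‖G i ω‖ ^ 2))]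

/-- Locations and fading are independent, so the joint law is a product. The fading is integrated
out first with the locations fixed, then the locations are averaged. -/
lemma prob_assoc_inter_success (hα : 2 < α) (hs₁ : 0 ≤ s₁) (hs₂ : 0 ≤ s₂) (hk : 0 < k)
    (h₁ : 0 < lam₁) (h₂ : 0 < lam₂) (hX : IsHomogeneousPPP P lam₁ X)
    (hY : IsHomogeneousPPP P lam₂ Y) (hXY : IndepFun (fun ω n => X n ω) (fun ω n => Y n ω) P)
    (hm : ∀ i, Measurable (G i)) (hl : ∀ i, P.map (G i) = complexNormal) (hi : iIndepFun G P)
    (hind : IndepFun (fun ω => ((fun n => X n ω), fun n => Y n ω)) (fun ω i => G i ω) P) :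
    P ({ω | k * nearestDist (fun n => X n ω) ≤ nearestDist (fun n => Y n ω)} ∩
        {ω | relInterference α s₁ s₂ (fun n => X n ω) (fun n => Y n ω) (fun i => G i ω)
          < ENNReal.ofReal (‖G (Sum.inl (nearest fun n => X n ω)) ω‖ ^ 2)})
      = ENNReal.ofReal (lam₁ / (lam₁ * (1 + rho s₁ α)
          + k ^ 2 * lam₂ * (1 + rho (s₂ / k ^ α) α))) := by
  have hXm : Measurable fun ω n => X n ω := measurable_pi_lambda _ hX.measurable_point
  have hYm : Measurable fun ω n => Y n ω := measurable_pi_lambda _ hY.measurable_point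
  have hGm : Measurable fun ω i => G i ω := measurable_pi_lambda _ hm
  set L : Ω → (ℕ → Plane) × (ℕ → Plane) := fun ω => ((fun n => X n ω), fun n => Y n ω) with hL
  have hLm : Measurable L := hXm.prodMk hYm
  let A : Set ((ℕ → Plane) × (ℕ → Plane)) := {p | k * nearestDist p.1 ≤ nearestDist p.2}
  let S : Set (((ℕ → Plane) × (ℕ → Plane)) × (ℕ ⊕ ℕ → ℂ)) :=
    Prod.fst ⁻¹' A ∩ {q | relInterference α s₁ s₂ q.1.1 q.1.2 q.2
      < ENNReal.ofReal (‖q.2 (Sum.inl (nearest q.1.1))‖ ^ 2)}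
  have hAm : MeasurableSet A := measurableSet_le (by fun_prop) (by fun_prop)
  have hSm : MeasurableSet S := by
    refine (measurable_fst hAm).inter (measurableSet_lt ?_ ?_)
    · refine Measurable.tsum fun i => ?_
      have h1 : Measurable fun q : ((ℕ → Plane) × (ℕ → Plane)) × (ℕ ⊕ ℕ → ℂ) =>
          relCoeff α s₁ s₂ q.1.1 q.1.2 i := (measurable_relCoeff α s₁ s₂ i).comp measurable_fst
      fun_prop
    · have h0 : Measurable fun q : ((ℕ → Plane) × (ℕ → Plane)) × (ℕ ⊕ ℕ → ℂ) =>
          fun n : ℕ => q.2 (Sum.inl n) := by fun_prop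
      have h1 : Measurable fun q : ((ℕ → Plane) × (ℕ → Plane)) × (ℕ ⊕ ℕ → ℂ) =>
          q.2 (Sum.inl (nearest q.1.1)) :=
        (measurable_eval_index (E := ℂ)).comp
          ((measurable_nearest.comp (measurable_fst.comp measurable_fst)).prodMk h0)
      fun_prop
  have hmap := (indepFun_iff_map_prod_eq_prod_map_map hLm.aemeasurable hGm.aemeasurable).1 hind
  have hP : P ({ω | k * nearestDist (fun n => X n ω) ≤ nearestDist (fun n => Y n ω)} ∩
        {ω | relInterference α s₁ s₂ (fun n => X n ω) (fun n => Y n ω) (fun i => G i ω)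
          < ENNReal.ofReal (‖G (Sum.inl (nearest fun n => X n ω)) ω‖ ^ 2)})
      = P.map (fun ω => (L ω, fun i => G i ω)) S := by
    rw [Measure.map_apply (hLm.prodMk hGm) hSm]; rfl
  have : IsProbabilityMeasure (P.map fun ω i => G i ω) :=
    Measure.isProbabilityMeasure_map hGm.aemeasurable
  rw [hP, hmap, Measure.prod_apply hSm, lintegral_map (measurable_measure_prodMk_left hSm) hLm,
    ← lintegral_assoc_mul_expNeg hα hs₁ hs₂ hk h₁ h₂ hX hY hXY]
  refine lintegral_congr fun ω => ?_
  rw [Measure.map_apply hGm (measurable_prodMk_left hSm)]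
  have hf := prob_fading_sum hm hl hi (relCoeff_nonneg (α := α) hs₁ hs₂ (L ω).1 (L ω).2)
    (i₀ := Sum.inl (nearest (L ω).1)) (by simp [relCoeff])
  by_cases hA : L ω ∈ A
  · have h1 : {ω | k * nearestDist (fun n => X n ω) ≤ nearestDist (fun n => Y n ω)}.indicator
        (1 : Ω → ℝ≥0∞) ω = 1 := Set.indicator_of_mem
        (s := {ω | k * nearestDist (fun n => X n ω) ≤ nearestDist (fun n => Y n ω)}) hA _
    rw [h1, one_mul, ← hf]
    congr 1
    ext ω'
    exact and_iff_right hA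
  · have h1 : {ω | k * nearestDist (fun n => X n ω) ≤ nearestDist (fun n => Y n ω)}.indicator
        (1 : Ω → ℝ≥0∞) ω = 0 := Set.indicator_of_notMem
        (s := {ω | k * nearestDist (fun n => X n ω) ≤ nearestDist (fun n => Y n ω)}) hA _
    rw [h1, zero_mul]
    refine measure_mono_null (t := ∅) ?_ measure_empty
    exact fun ω' h => hA h.1

lemma prob_assoc (hk : 0 < k) (h₁ : 0 < lam₁) (h₂ : 0 < lam₂) (hX : IsHomogeneousPPP P lam₁ X)
    (hY : IsHomogeneousPPP P lam₂ Y) (hXY : IndepFun (fun ω n => X n ω) (fun ω n => Y n ω) P) :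
    P {ω | k * nearestDist (fun n => X n ω) ≤ nearestDist (fun n => Y n ω)}
      = ENNReal.ofReal (lam₁ / (lam₁ + k ^ 2 * lam₂)) := by
  have hXm : Measurable fun ω n => X n ω := measurable_pi_lambda _ hX.measurable_point
  have hYm : Measurable fun ω n => Y n ω := measurable_pi_lambda _ hY.measurable_point
  -- With `s₁ = s₂ = 0` the interference disappears and only the association event remains; any
  -- exponent above 2 would do.
  have h := lintegral_assoc_mul_expNeg (α := 3) (by norm_num) le_rfl le_rfl hk h₁ h₂ hX hY hXY
  have h0 : ∀ ω i, relCoeff 3 0 0 (fun n => X n ω) (fun n => Y n ω) i = 0 := by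
    rintro ω (n | m) <;> simp [relCoeff]
  simp only [h0, add_zero, Real.log_one, ENNReal.ofReal_zero, tsum_zero, expNeg_zero, mul_one,
    zero_div, rho_zero (show (0 : ℝ) < 3 by norm_num)] at h
  rw [← h, lintegral_indicator_one]
  exact measurableSet_le ((measurable_nearestDist.comp hXm).const_mul k)
    (measurable_nearestDist.comp hYm)

/-- The two closed association events cover the space and their probabilities add up to 1, so their
intersection, the event of a tie, is null. -/
lemma ae_nearestDist_ne (hk : 0 < k) (h₁ : 0 < lam₁) (h₂ : 0 < lam₂)
    (hX : IsHomogeneousPPP P lam₁ X) (hY : IsHomogeneousPPP P lam₂ Y)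
    (hXY : IndepFun (fun ω n => X n ω) (fun ω n => Y n ω) P) :
    ∀ᵐ ω ∂P, k * nearestDist (fun n => X n ω) ≠ nearestDist (fun n => Y n ω) := by
  have hXm : Measurable fun ω n => X n ω := measurable_pi_lambda _ hX.measurable_point
  have hYm : Measurable fun ω n => Y n ω := measurable_pi_lambda _ hY.measurable_point
  have hA := prob_assoc hk h₁ h₂ hX hY hXY
  have hB := prob_assoc (inv_pos.2 hk) h₂ h₁ hY hX hXY.symm
  set A := {ω | k * nearestDist (fun n => X n ω) ≤ nearestDist (fun n => Y n ω)}
  set B := {ω | k⁻¹ * nearestDist (fun n => Y n ω) ≤ nearestDist (fun n => X n ω)}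
  have hBm : MeasurableSet B := measurableSet_le ((measurable_nearestDist.comp hYm).const_mul _)
    (measurable_nearestDist.comp hXm)
  have hBiff : ∀ ω, ω ∈ B ↔ nearestDist (fun n => Y n ω) ≤ k * nearestDist (fun n => X n ω) :=
    fun ω => inv_mul_le_iff₀ hk
  have hU : A ∪ B = Set.univ := by
    refine Set.eq_univ_of_forall fun ω => ?_
    rcases le_total (k * nearestDist (fun n => X n ω)) (nearestDist (fun n => Y n ω)) with h | h
    · exact Or.inl h
    · exact Or.inr ((hBiff ω).2 h)
  have h := measure_union_add_inter (μ := P) A hBm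
  rw [hU, measure_univ, hA, hB, ← ENNReal.ofReal_add (by positivity) (by positivity)] at h
  have h1 : lam₁ / (lam₁ + k ^ 2 * lam₂) + lam₂ / (lam₂ + k⁻¹ ^ 2 * lam₁) = 1 := by
    field_simp
    ring
  rw [h1, ENNReal.ofReal_one] at h
  have h2 : P (A ∩ B) = 0 := by
    rw [← ENNReal.add_right_inj ENNReal.one_ne_top, h, add_zero]
  filter_upwards [measure_eq_zero_iff_ae_notMem.1 h2] with ω hω heq
  exact hω ⟨heq.le, (hBiff ω).2 heq.ge⟩

end Fubini

/-! ### Vanishing noise and the success probabilities -/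

/-- The indicators converge at every `ω`. A strict inequality at zero noise persists for small noise
by continuity, and a failure at zero noise persists because noise only lowers the ratio. -/
lemma tendsto_measureReal_lt_div_add {Ω : Type*} [MeasurableSpace Ω] (Q : Measure Ω)
    [IsFiniteMeasure Q] {a I : Ω → ℝ≥0∞} (ham : Measurable a) (hIm : Measurable I)
    (ha : ∀ ω, a ω ≠ ∞) (c : ℝ≥0∞) :
    Tendsto (fun r : ℝ => Q.real {ω | c < a ω / (I ω + ENNReal.ofReal r)}) (𝓝[>] 0)
      (𝓝 (Q.real {ω | c < a ω / (I ω + ENNReal.ofReal 0)})) := by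
  have hms : ∀ r, MeasurableSet {ω | c < a ω / (I ω + ENNReal.ofReal r)} := fun r =>
    measurableSet_lt measurable_const (ham.div (hIm.add_const _))
  refine (ENNReal.tendsto_toReal (measure_ne_top _ _)).comp ?_
  refine tendsto_measure_of_ae_tendsto_indicator_of_isFiniteMeasure (𝓝[>] (0 : ℝ)) (hms 0) hms ?_
  filter_upwards with ω
  by_cases h : c < a ω / (I ω + ENNReal.ofReal 0)
  -- A nonzero numerator keeps the quotient continuous even at zero interference, where its limit is
  -- ∞.
  · have ha0 : a ω ≠ 0 := by
      intro h0
      simp [h0] at h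
    have ht : Tendsto (fun r : ℝ => a ω / (I ω + ENNReal.ofReal r)) (𝓝[>] 0)
        (𝓝 (a ω / (I ω + ENNReal.ofReal 0))) := by
      refine ENNReal.Tendsto.div tendsto_const_nhds (Or.inl ha0) ?_ (Or.inr (ha ω))
      exact tendsto_const_nhds.add ((ENNReal.continuous_ofReal.tendsto 0).mono_left
        nhdsWithin_le_nhds)
    filter_upwards [ht.eventually (lt_mem_nhds h)] with r hr
    exact iff_of_true hr h
  · filter_upwards with r
    refine iff_of_false (fun hr => h (lt_of_lt_of_le hr ?_)) h
    rw [ENNReal.ofReal_zero, add_zero]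
    exact ENNReal.div_le_div_left le_self_add _

section Network

variable {Ω : Type*} [MeasurableSpace Ω] {P : Measure Ω}
  {lam : Tier → ℝ} {X : Tier → ℕ → Ω → Plane} {h : Tier → ℕ → Ω → ℂ} {α δ S p₁ p₂ k : ℝ}
  {t₀ t₁ : Tier}

lemma IsTwoTierNetwork.measurable_location (hnet : IsTwoTierNetwork P lam X h) (t : Tier) :
    Measurable fun ω n => X t n ω :=
  measurable_pi_lambda _ (hnet.ppp t).measurable_point

lemma IsTwoTierNetwork.measurable_fading (hnet : IsTwoTierNetwork P lam X h) (t : Tier) :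
    Measurable fun ω n => h t n ω :=
  measurable_pi_lambda _ (hnet.fading_measurable t)

lemma cond_real_eq_div {A E : Set Ω} (hA : MeasurableSet A) {u v : ℝ} (hu : 0 ≤ u) (hv : 0 ≤ v)
    (h₁ : P A = ENNReal.ofReal u) (h₂ : P (A ∩ E) = ENNReal.ofReal v) :
    (P[|A]).real E = v / u := by
  rw [measureReal_def, cond_apply hA, h₁, h₂, ENNReal.toReal_mul, ENNReal.toReal_inv,
    ENNReal.toReal_ofReal hu, ENNReal.toReal_ofReal hv, div_eq_mul_inv, mul_comm]

variable [IsProbabilityMeasure P]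

/-- The joint probability that a user is served by the closest station of tier `t₀`, whose
transmit power is `S`, and that the signal to interference ratio exceeds `δ`. -/
lemma IsTwoTierNetwork.prob_assoc_inter_sir (hnet : IsTwoTierNetwork P lam X h) (ht : t₀ ≠ t₁)
    (hlam : ∀ t, 0 < lam t) (hα : 2 < α) (hδ : 0 < δ) (hS : 0 < S) (hp₁ : 0 ≤ p₁) (hp₂ : 0 ≤ p₂)
    (hk : 0 < k) :
    P ({ω | k * nearestDist (fun n => X t₀ n ω) ≤ nearestDist (fun n => X t₁ n ω)} ∩
        {ω | ENNReal.ofReal δ < rxPower α S (X t₀ (nearest fun n => X t₀ n ω) ω)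
            (h t₀ (nearest fun n => X t₀ n ω) ω) /
          (totalPowerExceptNearest α p₁ (fun n => X t₀ n ω) (fun n => h t₀ n ω)
            + totalPower α p₂ (fun n => X t₁ n ω) (fun n => h t₁ n ω))})
      = ENNReal.ofReal (lam t₀ / (lam t₀ * (1 + rho (δ * p₁ / S) α)
          + k ^ 2 * lam t₁ * (1 + rho (δ * p₂ / S / k ^ α) α))) := by
  let e : ℕ ⊕ ℕ → Tier × ℕ := Sum.elim (fun n => (t₀, n)) (fun n => (t₁, n))
  have he : Function.Injective e := by
    rintro (n | n) (m | m) hnm <;> simp_all [e, Prod.ext_iff]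
  let G : ℕ ⊕ ℕ → Ω → ℂ := fun i ω => h (e i).1 (e i).2 ω
  have hGe : ∀ ω, (fun i => G i ω) = Sum.elim (fun n => h t₀ n ω) (fun n => h t₁ n ω) := by
    intro ω; ext (n | n) <;> rfl
  have key := prob_assoc_inter_success (G := G) hα (div_nonneg (mul_nonneg hδ.le hp₁) hS.le)
    (div_nonneg (mul_nonneg hδ.le hp₂) hS.le) hk (hlam t₀) (hlam t₁) (hnet.ppp t₀) (hnet.ppp t₁)
    (hnet.tiers_indep.indepFun ht) (fun i => hnet.fading_measurable _ _)
    (fun i => hnet.fading_law _ _) (hnet.fading_indep.precomp he)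
    (hnet.locations_fading_indep.comp
      (φ := fun x : Tier → ℕ → Plane => (x t₀, x t₁))
      (ψ := fun (g : Tier → ℕ → ℂ) (i : ℕ ⊕ ℕ) => g (e i).1 (e i).2) (by fun_prop) (by fun_prop))
  rw [← key]
  refine measure_congr ?_
  filter_upwards [(hnet.ppp t₀).ae_ne_zero (hlam t₀).le] with ω hω
  refine propext (and_congr_right fun _ => ?_)
  have := lt_sinr_iff (α := α) (p₁ := p₁) (p₂ := p₂) hδ hS (x := fun n => X t₀ n ω)
    (y := fun n => X t₁ n ω) (norm_pos_iff.2 (hω _)) (fun n => h t₀ n ω) (fun n => h t₁ n ω)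
  rw [← hGe] at this
  exact this

end Network

/-- Absorbing `ζ` and `υ` into the powers reduces the RRH user to the F-AP situation with the tiers
exchanged. -/
lemma sinrR_eq {ζ υ : ℝ} (hζ : 0 ≤ ζ) (hυ : 0 ≤ υ) (α PF PR noise : ℝ) (x y : ℕ → Plane)
    (g h : ℕ → ℂ) :
    sinrR α PF PR ζ υ noise x y g h = rxPower α (ζ * PR) (y (nearest y)) (h (nearest y)) /
      (totalPowerExceptNearest α (υ * PR) y h + totalPower α PF x g + ENNReal.ofReal noise) := by
  rw [sinrR, ofReal_mul_rxPower hζ, ofReal_mul_totalPowerExceptNearest hυ,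
    add_comm (totalPower α PF x g)]

lemma upsilon_pos (B N : ℕ) : 0 < upsilon B N := Real.rpow_pos_of_pos two_pos _

section Success

variable {Ω : Type*} [MeasurableSpace Ω] {P : Measure Ω}
  {lam : Tier → ℝ} {X : Tier → ℕ → Ω → Plane} {h : Tier → ℕ → Ω → ℂ} {k α PF PR δ : ℝ} {B N : ℕ}

lemma IsTwoTierNetwork.measurable_nearestDist (hnet : IsTwoTierNetwork P lam X h) (t : Tier) :
    Measurable fun ω => nearestDist fun n => X t n ω :=
  FRAN.measurable_nearestDist.comp (hnet.measurable_location t)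

lemma IsTwoTierNetwork.measurableSet_assocF (hnet : IsTwoTierNetwork P lam X h) (k : ℝ) :
    MeasurableSet (assocF k X) :=
  measurableSet_le ((hnet.measurable_nearestDist _).const_mul k) (hnet.measurable_nearestDist _)

lemma IsTwoTierNetwork.measurableSet_assocR (hnet : IsTwoTierNetwork P lam X h) (k : ℝ) :
    MeasurableSet (assocR k X) :=
  measurableSet_lt (hnet.measurable_nearestDist _) ((hnet.measurable_nearestDist _).const_mul k)

lemma IsTwoTierNetwork.measurable_signal (hnet : IsTwoTierNetwork P lam X h) (t : Tier)
    (α p : ℝ) : Measurable fun ω =>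
      rxPower α p (X t (nearest fun n => X t n ω) ω) (h t (nearest fun n => X t n ω) ω) := by
  have h1 := measurable_rxPower_nearest α p
  have h2 := (hnet.measurable_location t).prodMk (hnet.measurable_fading t)
  have h3 := h1.comp h2
  simp only [Function.comp_def] at h3
  exact h3

lemma IsTwoTierNetwork.measurable_interference (hnet : IsTwoTierNetwork P lam X h) (t₀ t₁ : Tier)
    (α p₁ p₂ : ℝ) : Measurable fun ω =>
      totalPowerExceptNearest α p₁ (fun n => X t₀ n ω) (fun n => h t₀ n ω)
        + totalPower α p₂ (fun n => X t₁ n ω) (fun n => h t₁ n ω) := by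
  have h1 := (hnet.measurable_location t₀).prodMk (hnet.measurable_fading t₀)
  have h2 := (hnet.measurable_location t₁).prodMk (hnet.measurable_fading t₁)
  have h3 := (measurable_totalPowerExceptNearest α p₁).comp h1
  have h4 := (measurable_totalPower α p₂).comp h2
  exact h3.add h4

lemma IsTwoTierNetwork.tendsto_successF (hnet : IsTwoTierNetwork P lam X h)
    [IsProbabilityMeasure P] :
    Tendsto (fun noise => successF P X h k α PF PR δ noise) (𝓝[>] 0)
      (𝓝 (successF P X h k α PF PR δ 0)) :=
  tendsto_measureReal_lt_div_add _ (hnet.measurable_signal Tier.F α PF)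
    (hnet.measurable_interference Tier.F Tier.R α PF PR) (fun _ => ENNReal.ofReal_ne_top) _

lemma IsTwoTierNetwork.tendsto_successR (hnet : IsTwoTierNetwork P lam X h)
    [IsProbabilityMeasure P] (hN : 2 ≤ N) :
    Tendsto (fun noise => successR P X h k α PF PR B N δ noise) (𝓝[>] 0)
      (𝓝 (successR P X h k α PF PR B N δ 0)) := by
  simp only [successR, sinrR_eq (zeta_pos B hN).le (upsilon_pos B N).le]
  exact tendsto_measureReal_lt_div_add _ (hnet.measurable_signal Tier.R α (zeta B N * PR))
    (hnet.measurable_interference Tier.R Tier.F α (upsilon B N * PR) PF)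
    (fun _ => ENNReal.ofReal_ne_top) _

variable [IsProbabilityMeasure P]

lemma IsTwoTierNetwork.successF_zero (hnet : IsTwoTierNetwork P lam X h)
    (hlam : ∀ t, 0 < lam t) (hk : 0 < k) (hα : 2 < α) (hPF : 0 < PF) (hPR : 0 < PR) (hδ : 0 < δ) :
    successF P X h k α PF PR δ 0 = formulaF (lam Tier.F) (lam Tier.R) k α PF PR δ := by
  have hF := hlam Tier.F
  have hR := hlam Tier.R
  have hFR : Tier.F ≠ Tier.R := by simp
  have h1 := prob_assoc hk hF hR (hnet.ppp Tier.F) (hnet.ppp Tier.R)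
    (hnet.tiers_indep.indepFun hFR)
  have h2 := hnet.prob_assoc_inter_sir hFR hlam hα hδ hPF hPF.le hPR.le hk
  rw [mul_div_cancel_right₀ δ hPF.ne', div_div, mul_comm PF (k ^ α)] at h2
  have r1 : 0 ≤ rho δ α := rho_nonneg hδ.le
  have r2 : 0 ≤ rho (δ * PR / (k ^ α * PF)) α := rho_nonneg (by positivity)
  have hset : {ω | ENNReal.ofReal δ < sinrF α PF PR 0 (fun n => X Tier.F n ω)
      (fun n => X Tier.R n ω) (fun n => h Tier.F n ω) (fun n => h Tier.R n ω)}
      = {ω | ENNReal.ofReal δ < rxPower α PF (X Tier.F (nearest fun n => X Tier.F n ω) ω)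
            (h Tier.F (nearest fun n => X Tier.F n ω) ω) /
          (totalPowerExceptNearest α PF (fun n => X Tier.F n ω) (fun n => h Tier.F n ω)
            + totalPower α PR (fun n => X Tier.R n ω) (fun n => h Tier.R n ω))} := by
    simp only [sinrF, ENNReal.ofReal_zero, add_zero]
  rw [successF, hset, cond_real_eq_div (hnet.measurableSet_assocF k) (by positivity)
    (by positivity) h1 h2, formulaF]
  field_simp

lemma IsTwoTierNetwork.assocR_ae_eq (hnet : IsTwoTierNetwork P lam X h)
    (hlam : ∀ t, 0 < lam t) (hk : 0 < k) :
    assocR k X =ᵐ[P] {ω | k⁻¹ * nearestDist (fun n => X Tier.R n ω)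
      ≤ nearestDist (fun n => X Tier.F n ω)} := by
  have hFR : Tier.F ≠ Tier.R := by simp
  filter_upwards [ae_nearestDist_ne hk (hlam Tier.F) (hlam Tier.R) (hnet.ppp Tier.F)
    (hnet.ppp Tier.R) (hnet.tiers_indep.indepFun hFR)] with ω hω
  refine propext ?_
  change nearestDist (fun n => X Tier.R n ω) < k * nearestDist (fun n => X Tier.F n ω)
    ↔ k⁻¹ * nearestDist (fun n => X Tier.R n ω) ≤ nearestDist (fun n => X Tier.F n ω)
  rw [inv_mul_le_iff₀ hk]
  exact ⟨le_of_lt, fun hle => lt_of_le_of_ne hle hω.symm⟩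

/-- The joint formula with the tiers exchanged, `k⁻¹` for `k`, signal power `ζ PR` and own-tier
interference power `υ PR`. Ties being null, the strict association event may be replaced by the
closed one. -/
lemma IsTwoTierNetwork.successR_zero (hnet : IsTwoTierNetwork P lam X h)
    (hlam : ∀ t, 0 < lam t) (hk : 0 < k) (hα : 2 < α) (hPF : 0 < PF) (hPR : 0 < PR) (hδ : 0 < δ)
    (hN : 2 ≤ N) :
    successR P X h k α PF PR B N δ 0 = formulaR (lam Tier.F) (lam Tier.R) k α PF PR B N δ := by
  have hF := hlam Tier.F
  have hR := hlam Tier.R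
  have hζ := zeta_pos B hN
  have hυ := upsilon_pos B N
  have hRF : Tier.R ≠ Tier.F := by simp
  have h1 := prob_assoc (inv_pos.2 hk) hR hF (hnet.ppp Tier.R) (hnet.ppp Tier.F)
    (hnet.tiers_indep.indepFun hRF)
  have h2 := hnet.prob_assoc_inter_sir hRF hlam hα hδ (mul_pos hζ hPR) (mul_pos hυ hPR).le hPF.le
    (inv_pos.2 hk)
  have hae := hnet.assocR_ae_eq hlam hk
  rw [← measure_congr hae] at h1
  replace h2 := (measure_congr (hae.inter (ae_eq_refl _))).trans h2
  have e1 : δ * (upsilon B N * PR) / (zeta B N * PR) = upsilon B N * δ / zeta B N := by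
    field_simp
  have e2 : δ * PF / (zeta B N * PR) / k⁻¹ ^ α = δ * k ^ α * PF / (zeta B N * PR) := by
    have : 0 < k ^ α := Real.rpow_pos_of_pos hk α
    rw [Real.inv_rpow hk.le]
    field_simp
  rw [e1, e2] at h2
  have r1 : 0 ≤ rho (upsilon B N * δ / zeta B N) α := rho_nonneg (by positivity)
  have r2 : 0 ≤ rho (δ * k ^ α * PF / (zeta B N * PR)) α := rho_nonneg (by positivity)
  simp only [successR, sinrR_eq hζ.le hυ.le, ENNReal.ofReal_zero, add_zero]
  rw [cond_real_eq_div (hnet.measurableSet_assocR k) (by positivity) (by positivity) h1 h2,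
    formulaR]
  field_simp
  ring

end Success

end FRAN

theorem lemma2 {Ω : Type*} [MeasurableSpace Ω] (P : Measure Ω) [IsProbabilityMeasure P]
    (lam : FRAN.Tier → ℝ) (X : FRAN.Tier → ℕ → Ω → FRAN.Plane) (h : FRAN.Tier → ℕ → Ω → ℂ)
    (k α PF PR δ : ℝ) (B N : ℕ)
    (hlam : ∀ t, 0 < lam t) (hk : 0 < k) (hα : 2 < α) (hPF : 0 < PF) (hPR : 0 < PR)
    (hδ : 0 < δ) (hN : 2 ≤ N)
    (hnet : FRAN.IsTwoTierNetwork P lam X h) :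
    (FRAN.successF P X h k α PF PR δ 0
        = FRAN.formulaF (lam FRAN.Tier.F) (lam FRAN.Tier.R) k α PF PR δ ∧
      Tendsto (fun noise => FRAN.successF P X h k α PF PR δ noise) (𝓝[>] 0)
        (𝓝 (FRAN.formulaF (lam FRAN.Tier.F) (lam FRAN.Tier.R) k α PF PR δ))) ∧
    (FRAN.successR P X h k α PF PR B N δ 0
        = FRAN.formulaR (lam FRAN.Tier.F) (lam FRAN.Tier.R) k α PF PR B N δ ∧
      Tendsto (fun noise => FRAN.successR P X h k α PF PR B N δ noise) (𝓝[>] 0)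
        (𝓝 (FRAN.formulaR (lam FRAN.Tier.F) (lam FRAN.Tier.R) k α PF PR B N δ))) := by
  have hF := hnet.successF_zero hlam hk hα hPF hPR hδ
  have hR := hnet.successR_zero (B := B) hlam hk hα hPF hPR hδ hN
  exact ⟨⟨hF, hF ▸ hnet.tendsto_successF⟩, hR, hR ▸ hnet.tendsto_successR hN⟩
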